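/- Let $\mathbb K$ be a finite extension of some $\mathbb Q_p$, with ring of integers $\mathcal O$ and uniformizer $\varpi$. Let $\mathfrak g=\bigoplus_{k\ge 1}V_k$ be a finite-dimensional graded $\mathbb K$-Lie algebra, $[V_i,V_j]\subseteq V_{i+j}$ (so $\mathfrak g$ is nilpotent), and let $G$ be the corresponding graded $\mathbb K$-Lie group, i.e. a topological group with a homeomorphism $\exp:\mathfrak g\to G$ such that $\exp X\exp Y=\exp(\mathrm{BCH}(X,Y))$, where $\mathrm{BCH}$ is the Baker--Campbell--Hausdorff product. Let $Q=\sum_k k\dim V_k$ be the homogeneous dimension. Fix a basis $X_1,\dots,X_d$ of $\mathfrak g$ with $X_i\in V_{\nu_i}$ for each $i$, let $D_\gamma$ ($\gamma\in\mathbb K^*$) be the dilation of $\mathfrak g$ acting as $\gamma^k$ on $V_k$, and put $$\mathfrak g_0=\mathcal OX_1+\dots+\mathcal OX_d,\qquad G_n=\exp(D_{\varpi^n}\mathfrak g_0)\quad(n\in\mathbb Z).$$ Let $dx$ be the Haar measure on $G$ with $|G_0|=1$, where $|A|$ denotes the measure of $A$, and define $|e|_G=0$ and $|x|_G=|G_n|^{1/Q}$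 for $x\in G_n\setminus G_{n+1}$. Let $0<\lambda<Q$, $1<r\le s<\infty$, $\frac1r+\frac1{r'}=1$, and let $\alpha,\beta\in\mathbb R$ satisfy $$\beta<\frac Q{r'},\qquad \alpha<\frac Qs,\qquad \alpha+\beta\ge 0,\qquad \frac1s=\frac1r+\frac{\alpha+\beta+\lambda}{Q}-1 .$$ Then there is a constant $C>0$ such that for every $f:G\to\mathbb C$ with $|\cdot|_G^{\beta}f\in L^r(G)$ the integral $$I_\lambda f(x)=\int_G\frac{f(y)}{|y^{-1}x|_G^{\lambda}}\,dy$$ converges absolutely for almost every $x\in G$, the function $|\cdot|_G^{-\alpha}I_\lambda f$ belongs to $L^s(G)$, and $$\big\||\cdot|_G^{-\alpha}I_\lambda f\big\|_{L^s(G)}\le C\,\big\||\cdot|_G^{\beta}f\big\|_{L^r(G)} .$$ -/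

import Mathlib

open MeasureTheory
open scoped NNReal ENNReal

noncomputable section

namespace SteinWeiss

/-! ### The Baker-Campbell-Hausdorff product -/

/-- The right-nested bracket `[a₁, [a₂, [..., [aₘ₋₁, aₘ]]]]` of a list of elements. -/
def nestedBracket {L : Type*} [LieRing L] : List L → L
  | [] => 0
  | [a] => a
  | a :: b :: l => ⁅a, nestedBracket (b :: l)⁆

/-- The word `X^{a₁} Y^{b₁} X^{a₂} Y^{b₂} ⋯ X^{aₖ} Y^{bₖ}`, where `p i = (aᵢ, bᵢ)`. -/
def dynkinWord {L : Type*} (X Y : L) {k : ℕ} (p : Fin k → ℕ × ℕ) : List L :=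
  (List.ofFn fun i => List.replicate (p i).1 X ++ List.replicate (p i).2 Y).flatten

/-- The exponents `(aᵢ, bᵢ)`, `1 ≤ i ≤ k`, with `aᵢ + bᵢ > 0` for all `i` and
`∑ᵢ (aᵢ + bᵢ) = n`. -/
def dynkinIndex (n k : ℕ) : Finset (Fin k → ℕ × ℕ) :=
  (Fintype.piFinset fun _ => Finset.range (n + 1) ×ˢ Finset.range (n + 1)).filter fun p =>
    (∀ i, 0 < (p i).1 + (p i).2) ∧ ∑ i, ((p i).1 + (p i).2) = n

/-- The part of degree `n` of Dynkin's formula for `log (exp X exp Y)`. -/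
def bchTerm (K : Type*) {L : Type*} [Field K] [LieRing L] [LieAlgebra K L] (n : ℕ) (X Y : L) : L :=
  ∑ k ∈ Finset.Icc 1 n, ∑ p ∈ dynkinIndex n k,
    ((-1 : K) ^ (k - 1) / ((k : K) * (n : K) *
      ∏ i, (((p i).1.factorial : K) * ((p i).2.factorial : K)))) • nestedBracket (dynkinWord X Y p)

/-- The Baker-Campbell-Hausdorff product on a nilpotent Lie algebra over a field of characteristic
zero; nilpotency makes the sum finite. -/
def bch (K : Type*) {L : Type*} [Field K] [LieRing L] [LieAlgebra K L] (X Y : L) : L :=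
  ∑ᶠ n : ℕ, bchTerm K n X Y

/-! ### Graded Lie groups over a local field -/

/-- A graded `K`-Lie group: a topological group `G`, with a grading
`g = ⊕ₖ Vₖ`, `k ≥ 1`, `[Vᵢ, Vⱼ] ⊆ Vᵢ₊ⱼ`, of its (finite-dimensional) Lie algebra `g`, such that `G`
is identified by the exponential map with `g` under the Baker-Campbell-Hausdorff product.
Nilpotency of `g` follows from the grading. -/
structure GradedLieGroup (K g G : Type*) [Field K] [LieRing g] [LieAlgebra K g]
    [TopologicalSpace g] [Group G] [TopologicalSpace G] where
  /-- the layers of the grading -/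
  V : ℕ → Submodule K g
  isInternal : DirectSum.IsInternal V
  V_zero : V 0 = ⊥
  lie_mem : ∀ (i j : ℕ) (X Y : g), X ∈ V i → Y ∈ V j → ⁅X, Y⁆ ∈ V (i + j)
  /-- the exponential map -/
  exp : g ≃ₜ G
  exp_mul_exp : ∀ X Y : g, exp X * exp Y = exp (bch K X Y)

namespace GradedLieGroup

variable {K g G : Type*} [NontriviallyNormedField K] [LieRing g] [LieAlgebra K g]
  [TopologicalSpace g] [Group G] [TopologicalSpace G]

/-- The homogeneous dimension `Q = ∑ₖ k · dim Vₖ`. -/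
def homDim (H : GradedLieGroup K g G) : ℕ :=
  ∑ᶠ k : ℕ, k * Module.finrank K (H.V k)

/-- A basis `X₁, ..., X_d` of the Lie algebra adapted to the grading: `Xᵢ` lies in the layer of
degree `weight i`. -/
structure HomogeneousBasis (H : GradedLieGroup K g G) (d : ℕ) where
  basis : Module.Basis (Fin d) K g
  weight : Fin d → ℕ
  basis_mem : ∀ i, basis i ∈ H.V (weight i)

namespace HomogeneousBasis

variable {H : GradedLieGroup K g G} {d : ℕ} (B : H.HomogeneousBasis d)

/-- The dilation `D_γ` of the Lie algebra: multiplication by `γ ^ k` on the layer `Vₖ`. -/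
def dilation (γ : K) : g →ₗ[K] g :=
  B.basis.constr K fun i => γ ^ B.weight i • B.basis i

/-- The lattice `g₀ = 𝒪 X₁ + ⋯ + 𝒪 X_d`, where `𝒪` is the ring of integers of `K`. -/
def lattice : Set g :=
  {X | ∀ i, ‖B.basis.repr X i‖ ≤ 1}

/-- The sets `Gₙ = exp (D_γ g₀)` with `γ = ϖ ^ n`, for a uniformizer `ϖ` of `K`. -/
def filtration (ϖ : K) (n : ℤ) : Set G :=
  H.exp '' (B.dilation (ϖ ^ n) '' B.lattice)

open Classical in
/-- The function `|·|_G`: it is `μ(Gₙ)^{1/Q}` on `Gₙ \ Gₙ₊₁`, and `0` at the identity (the only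
point outside all these differences). -/
def quasiNorm [MeasurableSpace G] (ϖ : K) (μ : Measure G) (x : G) : ℝ :=
  if h : ∃ n : ℤ, x ∈ B.filtration ϖ n \ B.filtration ϖ (n + 1) then
    μ.real (B.filtration ϖ h.choose) ^ (1 / (H.homDim : ℝ))
  else 0

end HomogeneousBasis

end GradedLieGroup

/-- `ϖ` generates the maximal ideal of the ring of integers of the discretely valued field `K`. -/
structure IsUniformizer {K : Type*} [NormedField K] (ϖ : K) : Prop where
  ne_zero : ϖ ≠ 0
  norm_lt_one : ‖ϖ‖ < 1
  le_norm : ∀ x : K, ‖x‖ < 1 → ‖x‖ ≤ ‖ϖ‖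

/-- The integrand `y ↦ f(y) / |y⁻¹x|^lam` of the Riesz-type operator, for a function `N = |·|`. -/
def rieszIntegrand {G : Type*} [Group G] (N : G → ℝ) (lam : ℝ) (f : G → ℂ) (x y : G) : ℂ :=
  f y / ((N (y⁻¹ * x) ^ lam : ℝ) : ℂ)

/-- The operator `I_lam f(x) = ∫ f(y) / |y⁻¹x|^lam dy`, for a function `N = |·|`. -/
def rieszOp {G : Type*} [Group G] [MeasurableSpace G] (N : G → ℝ) (μ : Measure G) (lam : ℝ)
    (f : G → ℂ) (x : G) : ℂ :=
  ∫ y, rieszIntegrand N lam f x y ∂μ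

end SteinWeiss

end

/-! The quasi-norm is comparable to an ultrametric gauge built from subgroups. The balls G_n need
not be subgroups, since BCH has denominators; but G_0 is compact and open, so the elements all of
whose contracted dilates stabilize G_0 form a subgroup U with G_m ⊆ U ⊆ G_0 for some m. Dilations
respect the grading, hence brackets, hence BCH, so they are group automorphisms, and the dilates V_n
of U by ϖ^(-n) are increasing subgroups with G_{m-n} ⊆ V_n ⊆ G_{-n}. Dilation by ϖ scales Haar
measure by some χ < 1. With Λ = χ⁻¹ this gives μ(V_n) ≤ Λ^n, and |x|^Q is comparable to the gauge
that equals Λ^n on the shell V_n \ V_{n-1} (`exists_quasiNorm_rpow_le`).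

For the gauge (`exists_lintegral_kernel_rpow_le`) the kernel is split by the shells of x and y. If
these differ, y⁻¹x has the larger of the two gauges. Hölder on each shell then leaves a convolution
of the sequence of shell L^r norms with a geometric sequence, which converges because β < Q/r' and α
< Q/s, and which maps ℓ^r to ℓ^s (`tsum_tsum_rpow_le`). If the shells agree, Hedberg's argument
(`exists_diagonal_le`) bounds that part by a power of the maximal function over the cosets xV_j
times a power of the L^r norm. The maximal operator is bounded on L^r: cosets are nested or
disjoint, so the weak type bound needs no covering lemma (`mul_measure_lt_cosetIntegral_le`).

All estimates concern the integral of absolute values, so almost everywhere convergence comes with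
the inequality. -/

noncomputable section

namespace SteinWeiss

/-! ### Geometric series and sequence-space inequalities -/

section Series

variable {Λ : ℝ≥0∞}

lemma rpow_ne_top_of_one_lt (h1 : 1 < Λ) (htop : Λ ≠ ⊤) (t : ℝ) : Λ ^ t ≠ ⊤ :=
  ENNReal.rpow_ne_top_of_ne_zero (zero_lt_one.trans h1).ne' htop

lemma rpow_ne_zero_of_one_lt (h1 : 1 < Λ) (htop : Λ ≠ ⊤) (t : ℝ) : Λ ^ t ≠ 0 := by
  simp [ENNReal.rpow_eq_zero_iff, htop, (zero_lt_one.trans h1).ne']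

lemma rpow_mul_rpow (h1 : 1 < Λ) (htop : Λ ≠ ⊤) (s t : ℝ) : Λ ^ s * Λ ^ t = Λ ^ (s + t) :=
  (ENNReal.rpow_add s t (zero_lt_one.trans h1).ne' htop).symm

lemma rpow_neg_mul_rpow_self (h1 : 1 < Λ) (htop : Λ ≠ ⊤) (t : ℝ) : Λ ^ (-t) * Λ ^ t = 1 := by
  rw [rpow_mul_rpow h1 htop]; simp

lemma tsum_rpow_neg_ne_top (h1 : 1 < Λ) {ε : ℝ} (hε : 0 < ε) :
    ∑' k : ℕ, Λ ^ (-((k : ℝ) * ε)) ≠ ⊤ := by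
  have h (k : ℕ) : Λ ^ (-((k : ℝ) * ε)) = ((Λ ^ ε)⁻¹) ^ k := by
    rw [ENNReal.rpow_neg, mul_comm, ENNReal.rpow_mul, ENNReal.rpow_natCast, ENNReal.inv_pow]
  simp_rw [h, ENNReal.tsum_geometric]
  simp [ENNReal.inv_eq_top, tsub_eq_zero_iff_le, ENNReal.one_lt_rpow h1 hε]

/-- A two-sided geometric series, cut off at height `A`, is comparable to its largest term. -/
lemma exists_tsum_rpow_le (h1 : 1 < Λ) (htop : Λ ≠ ⊤) {ε : ℝ} (hε : 0 < ε) :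
    ∃ C : ℝ≥0∞, C ≠ ⊤ ∧ ∀ A : ℝ≥0∞,
      ∑' j : ℤ, (if Λ ^ (j : ℝ) ≤ A then Λ ^ ((j : ℝ) * ε) else 0) ≤ C * A ^ ε := by
  refine ⟨∑' k : ℕ, Λ ^ (-((k : ℝ) * ε)), tsum_rpow_neg_ne_top h1 hε, fun A => ?_⟩
  rcases eq_or_ne A 0 with rfl | hA0
  · refine (ENNReal.tsum_eq_zero.2 fun j => if_neg ?_).trans_le zero_le
    exact not_le.2 (pos_iff_ne_zero.2 (rpow_ne_zero_of_one_lt h1 htop _))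
  rcases eq_or_ne A ⊤ with rfl | hAt
  · have : (∑' k : ℕ, Λ ^ (-((k : ℝ) * ε))) ≠ 0 := by
      intro h
      have := ENNReal.tsum_eq_zero.1 h 0
      simp at this
    rw [ENNReal.top_rpow_of_pos hε, ENNReal.mul_top this]
    exact le_top
  -- n is the last index below the cutoff, so the nonzero terms are those with j = n - k, k ≥ 0.
  obtain ⟨n, hn, hn'⟩ := ENNReal.exists_mem_Ico_zpow hA0 hAt h1 htop
  rw [← ENNReal.rpow_intCast] at hn hn'
  have hinj : Function.Injective fun k : ℕ => n - (k : ℤ) := fun a b h => by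
    simp only at h; omega
  rw [← hinj.tsum_eq, ← ENNReal.tsum_mul_right]
  · refine ENNReal.tsum_le_tsum fun k => ?_
    split_ifs with h
    · calc Λ ^ (((n - (k : ℤ) : ℤ) : ℝ) * ε) = Λ ^ (-((k : ℝ) * ε)) * (Λ ^ (n : ℝ)) ^ ε := by
            rw [← ENNReal.rpow_mul, rpow_mul_rpow h1 htop]; push_cast; ring_nf
        _ ≤ _ := by gcongr
    · exact zero_le
  · intro j hj
    have hj : Λ ^ (j : ℝ) ≤ A := by
      by_contra hc
      exact hj (if_neg hc)
    have : j < n + 1 := by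
      by_contra! hc
      refine absurd (hj.trans_lt hn') (not_lt.2 ?_)
      exact ENNReal.rpow_le_rpow_of_exponent_le h1.le (by exact_mod_cast hc)
    exact ⟨(n - j).toNat, by simp only; omega⟩

/-- Discrete layer-cake bound. -/
lemma rpow_le_tsum_layers (h1 : 1 < Λ) (htop : Λ ≠ ⊤) {p : ℝ} (hp : 0 < p) (A : ℝ≥0∞) :
    A ^ p ≤ ∑' j : ℤ, (if Λ ^ (j : ℝ) < A then Λ ^ (((j : ℝ) + 1) * p) else 0) := by
  rcases eq_or_ne A 0 with rfl | hA0
  · simp [ENNReal.zero_rpow_of_pos hp]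
  rcases eq_or_ne A ⊤ with rfl | hAt
  · have hinj : Function.Injective fun k : ℕ => (k : ℤ) := fun a b h => by simpa using h
    refine le_trans ?_ (ENNReal.tsum_comp_le_tsum_of_injective hinj _)
    refine le_trans ?_ (ENNReal.tsum_le_tsum (f := fun _ => 1) fun k => ?_)
    · rw [ENNReal.tsum_const_eq_top_of_ne_zero one_ne_zero]; exact le_top
    · rw [if_pos (rpow_ne_top_of_one_lt h1 htop _).lt_top]
      exact ENNReal.one_le_rpow h1.le (by positivity)
  obtain ⟨n, hn, hn'⟩ := ENNReal.exists_mem_Ioc_zpow hA0 hAt h1 htop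
  rw [← ENNReal.rpow_intCast] at hn hn'
  refine le_trans ?_ (ENNReal.le_tsum n)
  rw [if_pos hn, ENNReal.rpow_mul]
  push_cast at hn'
  gcongr

/-- Summing the smaller of a growing and a decaying geometric sequence. -/
lemma exists_tsum_le_of_le_of_le (h1 : 1 < Λ) (htop : Λ ≠ ⊤) {σ τ : ℝ} (hσ : 0 < σ) (hτ : 0 < τ) :
    ∃ C : ℝ≥0∞, C ≠ ⊤ ∧ ∀ (M B : ℝ≥0∞) (u : ℤ → ℝ≥0∞), (∀ j : ℤ, u j ≤ Λ ^ ((j : ℝ) * σ) * M) →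
      (∀ j : ℤ, u j ≤ Λ ^ (-((j : ℝ) * τ)) * B) →
      ∑' j, u j ≤ C * (M ^ (τ / (σ + τ)) * B ^ (σ / (σ + τ))) := by
  obtain ⟨C₁, hC₁, hσ'⟩ := exists_tsum_rpow_le h1 htop hσ
  obtain ⟨C₂, hC₂, hτ'⟩ := exists_tsum_rpow_le h1 htop hτ
  -- The extra 1 keeps the constant nonzero, so that the right side is ⊤ when M or B is.
  refine ⟨C₁ + C₂ + 1, by simp [hC₁, hC₂], fun M B u hM hB => ?_⟩
  have hst : 0 < σ + τ := add_pos hσ hτ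
  rcases eq_or_ne M 0 with rfl | hM0
  · exact (ENNReal.tsum_eq_zero.2 fun j => by simpa using hM j).trans_le zero_le
  rcases eq_or_ne B 0 with rfl | hB0
  · exact (ENNReal.tsum_eq_zero.2 fun j => by simpa using hB j).trans_le zero_le
  have hC0 : C₁ + C₂ + 1 ≠ 0 := by simp
  rcases eq_or_ne M ⊤ with rfl | hMt
  · rw [ENNReal.top_rpow_of_pos (by positivity), ENNReal.top_mul, ENNReal.mul_top hC0]
    · exact le_top
    · simp [ENNReal.rpow_eq_zero_iff, hB0, (div_pos hσ hst).le]
  rcases eq_or_ne B ⊤ with rfl | hBt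
  · rw [ENNReal.top_rpow_of_pos (by positivity), ENNReal.mul_top, ENNReal.mul_top hC0]
    · exact le_top
    · simp [ENNReal.rpow_eq_zero_iff, hM0, (div_pos hτ hst).le]
  -- T is the value of Λ^j at which the growing and the decaying bound coincide.
  set T : ℝ≥0∞ := (B / M) ^ (1 / (σ + τ)) with hT
  have hTinv : (M / B) ^ (1 / (σ + τ)) = T⁻¹ := by
    rw [hT, ← ENNReal.inv_rpow, ENNReal.inv_div (Or.inl hMt) (Or.inl hM0)]
  have hpow {x y : ℝ≥0∞} (hx0 : x ≠ 0) (hxt : x ≠ ⊤) {t : ℝ} (ht : 0 ≤ t) :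
      (y / x) ^ t * x = x ^ (1 - t) * y ^ t := by
    nth_rw 2 [← ENNReal.rpow_one x]
    rw [ENNReal.div_rpow_of_nonneg _ _ ht, div_eq_mul_inv, ← ENNReal.rpow_neg, mul_assoc,
      ← ENNReal.rpow_add _ _ hx0 hxt, mul_comm]
    ring_nf
  have e1 : T ^ σ * M = M ^ (τ / (σ + τ)) * B ^ (σ / (σ + τ)) := by
    rw [hT, ← ENNReal.rpow_mul, one_div_mul_eq_div, hpow hM0 hMt (by positivity)]
    congr 2
    field_simp
    ring
  have e2 : T⁻¹ ^ τ * B = M ^ (τ / (σ + τ)) * B ^ (σ / (σ + τ)) := by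
    rw [← hTinv, ← ENNReal.rpow_mul, one_div_mul_eq_div, hpow hB0 hBt (by positivity), mul_comm]
    congr 2
    field_simp
    ring
  calc ∑' j, u j
      ≤ ∑' j : ℤ, ((if Λ ^ (j : ℝ) ≤ T then Λ ^ ((j : ℝ) * σ) else 0) * M +
          (if Λ ^ ((-j : ℤ) : ℝ) ≤ T⁻¹ then Λ ^ (((-j : ℤ) : ℝ) * τ) else 0) * B) := by
        refine ENNReal.tsum_le_tsum fun j => ?_
        by_cases hj : Λ ^ (j : ℝ) ≤ T
        · rw [if_pos hj]
          exact (hM j).trans le_self_add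
        · have hj' : Λ ^ ((-j : ℤ) : ℝ) ≤ T⁻¹ := by
            push_cast
            rw [ENNReal.rpow_neg]
            exact ENNReal.inv_le_inv.2 (not_le.1 hj).le
          rw [if_pos hj']
          refine (hB j).trans (le_trans (le_of_eq ?_) le_add_self)
          push_cast
          ring_nf
    _ = (∑' j : ℤ, if Λ ^ (j : ℝ) ≤ T then Λ ^ ((j : ℝ) * σ) else 0) * M +
          (∑' j : ℤ, if Λ ^ (j : ℝ) ≤ T⁻¹ then Λ ^ ((j : ℝ) * τ) else 0) * B := by
        rw [ENNReal.tsum_add, ENNReal.tsum_mul_right, ENNReal.tsum_mul_right,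
          ← (Equiv.neg ℤ).tsum_eq
            (fun j : ℤ => if Λ ^ (j : ℝ) ≤ T⁻¹ then Λ ^ ((j : ℝ) * τ) else 0)]
        rfl
    _ ≤ C₁ * T ^ σ * M + C₂ * T⁻¹ ^ τ * B := by
        gcongr
        exacts [hσ' T, hτ' _]
    _ = (C₁ + C₂) * (M ^ (τ / (σ + τ)) * B ^ (σ / (σ + τ))) := by
        rw [mul_assoc, mul_assoc, e1, e2, add_mul]
    _ ≤ _ := mul_le_mul_left le_self_add _

lemma tsum_rpow_le_rpow_tsum {ι : Type*} {p : ℝ} (hp : 1 ≤ p) (u : ι → ℝ≥0∞) :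
    ∑' i, u i ^ p ≤ (∑' i, u i) ^ p := by
  have h (x : ℝ≥0∞) : x ^ p = x * x ^ (p - 1) := by
    nth_rw 2 [← ENNReal.rpow_one x]
    rw [← ENNReal.rpow_add_of_nonneg _ _ zero_le_one (by linarith)]
    ring_nf
  rw [h (∑' i, u i), ← ENNReal.tsum_mul_right]
  refine ENNReal.tsum_le_tsum fun i => ?_
  rw [h]
  refine mul_le_mul_right ?_ _
  exact ENNReal.rpow_le_rpow (ENNReal.le_tsum i) (by linarith)

/-- Jensen's inequality for a weighted series. -/
lemma tsum_mul_rpow_le {ι : Type*} {p : ℝ} (hp : 1 < p) (w φ : ι → ℝ≥0∞) :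
    (∑' i, w i * φ i) ^ p ≤ (∑' i, w i) ^ (p - 1) * ∑' i, w i * φ i ^ p := by
  let _ : MeasurableSpace ι := ⊤
  have hp0 : 0 < p := by linarith
  have hpq : (p.conjExponent).HolderConjugate p := (Real.HolderConjugate.conjExponent hp).symm
  -- Hölder for counting measure, with w split as w^(1/p') · w^(1/p).
  have hH := ENNReal.lintegral_mul_le_Lp_mul_Lq (Measure.count (α := ι)) hpq
    (f := fun i => w i ^ (1 / p.conjExponent)) (g := fun i => w i ^ (1 / p) * φ i)
    (measurable_from_top).aemeasurable (measurable_from_top).aemeasurable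
  simp only [lintegral_count, Pi.mul_apply] at hH
  have e1 (i : ι) : w i ^ (1 / p.conjExponent) * (w i ^ (1 / p) * φ i) = w i * φ i := by
    rw [← mul_assoc, ← ENNReal.rpow_add_of_nonneg _ _ (by have := hpq.pos; positivity)
      (by positivity)]
    simp [hpq.inv_add_inv_eq_one]
  have e2 (i : ι) : (w i ^ (1 / p.conjExponent)) ^ p.conjExponent = w i := by
    rw [← ENNReal.rpow_mul, one_div_mul_cancel hpq.pos.ne', ENNReal.rpow_one]
  have e3 (i : ι) : (w i ^ (1 / p) * φ i) ^ p = w i * φ i ^ p := by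
    rw [ENNReal.mul_rpow_of_nonneg _ _ hp0.le, ← ENNReal.rpow_mul, one_div_mul_cancel hp0.ne',
      ENNReal.rpow_one]
  simp only [e1, e2, e3] at hH
  calc (∑' i, w i * φ i) ^ p
      ≤ ((∑' i, w i) ^ (1 / p.conjExponent) * (∑' i, w i * φ i ^ p) ^ (1 / p)) ^ p := by gcongr
    _ = _ := by
      rw [ENNReal.mul_rpow_of_nonneg _ _ hp0.le, ← ENNReal.rpow_mul, ← ENNReal.rpow_mul,
        one_div_mul_cancel hp0.ne', ENNReal.rpow_one]
      congr 2
      rw [Real.conjExponent]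
      field_simp

/-- Convolution with a geometric sequence maps `ℓ^r` to `ℓ^s`. -/
lemma tsum_tsum_rpow_le {r s : ℝ} (hr : 0 < r) (hrs : r ≤ s) (hs : 1 < s) (w : ℕ → ℝ≥0∞)
    (e : ℕ → Equiv.Perm ℤ) (φ : ℤ → ℝ≥0∞) :
    ∑' n, (∑' k, w k * φ (e k n)) ^ s ≤ (∑' k, w k) ^ s * (∑' n, φ n ^ r) ^ (s / r) := by
  have hW : (∑' k, w k) ^ s = (∑' k, w k) ^ (s - 1) * ∑' k, w k := by
    nth_rw 3 [← ENNReal.rpow_one (∑' k, w k)]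
    rw [← ENNReal.rpow_add_of_nonneg _ _ (by linarith) zero_le_one]
    ring_nf
  have hφ : ∑' n, φ n ^ s ≤ (∑' n, φ n ^ r) ^ (s / r) := by
    refine le_trans (le_of_eq (tsum_congr fun n => ?_))
      (tsum_rpow_le_rpow_tsum ((one_le_div hr).2 hrs) fun n => φ n ^ r)
    rw [← ENNReal.rpow_mul, mul_div_cancel₀ _ hr.ne']
  -- Jensen, then an exchange of sums: each `e k` permutes ℤ and so preserves the ℓ^s sum, which the
  -- ℓ^r sum controls.
  calc ∑' n, (∑' k, w k * φ (e k n)) ^ s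
      ≤ ∑' n, (∑' k, w k) ^ (s - 1) * ∑' k, w k * φ (e k n) ^ s :=
        ENNReal.tsum_le_tsum fun n => tsum_mul_rpow_le hs w fun k => φ (e k n)
    _ = (∑' k, w k) ^ (s - 1) * ∑' k, w k * ∑' n, φ n ^ s := by
        rw [ENNReal.tsum_mul_left, ENNReal.tsum_comm]
        congr 1
        refine tsum_congr fun k => ?_
        rw [ENNReal.tsum_mul_left, (e k).tsum_eq fun n => φ n ^ s]
    _ ≤ _ := by
        rw [ENNReal.tsum_mul_right, ← mul_assoc, hW]
        gcongr

end Series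

lemma lintegral_rpow_le_measure_mul {α : Type*} [MeasurableSpace α] (μ : Measure α) {p : ℝ}
    (hp : 1 < p) {f : α → ℝ≥0∞} (hf : AEMeasurable f μ) :
    ∫⁻ x, f x ∂μ ≤ μ Set.univ ^ (1 - 1 / p) * (∫⁻ x, f x ^ p ∂μ) ^ (1 / p) := by
  have hpq : (p.conjExponent).HolderConjugate p := (Real.HolderConjugate.conjExponent hp).symm
  have hH := ENNReal.lintegral_mul_le_Lp_mul_Lq μ hpq (f := fun _ => 1) aemeasurable_const hf
  have : 1 - 1 / p = 1 / p.conjExponent := by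
    have := hpq.inv_add_inv_eq_one
    simp only [one_div]; linarith
  rw [this]
  simpa using hH

/-- An exhaustive and separated increasing family of measurable subgroups, with `V n` of measure at
most `Λ ^ n`. -/
structure SubgroupScale {G : Type*} [Group G] [MeasurableSpace G] (μ : Measure G)
    (Λ : ℝ≥0∞) where
  V : ℤ → Subgroup G
  mono : Monotone V
  measurableSet : ∀ n, MeasurableSet (V n : Set G)
  measure_le : ∀ n : ℤ, μ (V n) ≤ Λ ^ (n : ℝ)
  exists_mem : ∀ x, ∃ n, x ∈ V n
  exists_notMem : ∀ x, x ≠ 1 → ∃ n, x ∉ V n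
  one_lt : 1 < Λ
  ne_top : Λ ≠ ⊤

/-! ### Cosets and their maximal function -/

namespace SubgroupScale

variable {G : Type*} [Group G] [MeasurableSpace G] {μ : Measure G} {Λ : ℝ≥0∞}
  (S : SubgroupScale μ Λ)

/-- The left coset `x V_j`. -/
def coset (j : ℤ) (x : G) : Set G := {y | x⁻¹ * y ∈ S.V j}

lemma mem_coset_comm {j : ℤ} {x y : G} : y ∈ S.coset j x ↔ x ∈ S.coset j y := by
  simp only [coset, Set.mem_ofPred_eq]
  rw [← inv_mem_iff]
  simp

lemma coset_eq {j : ℤ} {x y : G} (h : y ∈ S.coset j x) : S.coset j y = S.coset j x := by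
  ext z
  simp only [coset, Set.mem_ofPred_eq] at h ⊢
  rw [← Subgroup.mul_mem_cancel_left _ h]
  simp [mul_assoc]

lemma coset_mono {i j : ℤ} (h : i ≤ j) (x : G) : S.coset i x ⊆ S.coset j x :=
  fun _ hy => S.mono h hy

/-- The integral of `F` over `x V_j`. -/
def cosetIntegral (F : G → ℝ≥0∞) (j : ℤ) (x : G) : ℝ≥0∞ := ∫⁻ y in S.coset j x, F y ∂μ

/-- The maximal function of the family of cosets. -/
def maximal (F : G → ℝ≥0∞) (x : G) : ℝ≥0∞ :=
  ⨆ j : ℤ, Λ ^ (-(j : ℝ)) * S.cosetIntegral F j x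

lemma cosetIntegral_le_maximal (F : G → ℝ≥0∞) (j : ℤ) (x : G) :
    S.cosetIntegral F j x ≤ Λ ^ (j : ℝ) * S.maximal F x := by
  have h := rpow_neg_mul_rpow_self S.one_lt S.ne_top j
  calc S.cosetIntegral F j x
      = Λ ^ (j : ℝ) * (Λ ^ (-(j : ℝ)) * S.cosetIntegral F j x) := by
        rw [← mul_assoc, mul_comm (Λ ^ (j : ℝ)), h, one_mul]
    _ ≤ _ := by
        gcongr
        exact le_iSup (fun j : ℤ => Λ ^ (-(j : ℝ)) * S.cosetIntegral F j x) j

variable [MeasurableMul₂ G]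

lemma measurableSet_coset (j : ℤ) (x : G) : MeasurableSet (S.coset j x) :=
  (by fun_prop : Measurable fun y : G => x⁻¹ * y) (S.measurableSet j)

lemma measure_coset_le [μ.IsMulLeftInvariant] (j : ℤ) (x : G) :
    μ (S.coset j x) ≤ Λ ^ (j : ℝ) :=
  (measure_preimage_mul μ x⁻¹ (S.V j)).trans_le (S.measure_le j)

lemma cosetIntegral_eq_lintegral_indicator (F : G → ℝ≥0∞) (j : ℤ) (x : G) :
    S.cosetIntegral F j x =
      ∫⁻ y, {p : G × G | p.2 ∈ S.coset j p.1}.indicator (fun p => F p.2) (x, y) ∂μ := by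
  rw [cosetIntegral, ← lintegral_indicator (S.measurableSet_coset j x)]
  rfl

variable [MeasurableInv G]

lemma measurableSet_coset_prod (j : ℤ) : MeasurableSet {p : G × G | p.2 ∈ S.coset j p.1} :=
  (by fun_prop : Measurable fun p : G × G => p.1⁻¹ * p.2) (S.measurableSet j)

variable [SFinite μ]

lemma measurable_cosetIntegral {F : G → ℝ≥0∞} (hF : Measurable F) (j : ℤ) :
    Measurable (S.cosetIntegral F j) := by
  simp_rw [funext (S.cosetIntegral_eq_lintegral_indicator F j)]
  exact Measurable.lintegral_prod_right'
    ((hF.comp measurable_snd).indicator (S.measurableSet_coset_prod j))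

lemma measurable_maximal {F : G → ℝ≥0∞} (hF : Measurable F) : Measurable (S.maximal F) :=
  Measurable.iSup fun j => (S.measurable_cosetIntegral hF j).const_mul _

variable [μ.IsMulLeftInvariant]

/-- Tonelli: y ∈ xV_j is symmetric in x and y, so a point y of E is counted with weight at most
μ(yV_j) ≤ Λ^j. A point outside E is not counted, as E is a union of cosets. -/
lemma lintegral_cosetIntegral_le {F : G → ℝ≥0∞} (hF : Measurable F) {j : ℤ} {E : Set G}
    (hE : MeasurableSet E) (hinv : ∀ x ∈ E, S.coset j x ⊆ E) :
    ∫⁻ x in E, S.cosetIntegral F j x ∂μ ≤ Λ ^ (j : ℝ) * ∫⁻ y in E, F y ∂μ := by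
  simp_rw [S.cosetIntegral_eq_lintegral_indicator F j]
  rw [lintegral_lintegral_swap, ← lintegral_const_mul _ hF]
  · rw [← lintegral_indicator hE]
    refine lintegral_mono fun y => ?_
    have key : ∫⁻ x in E, {p : G × G | p.2 ∈ S.coset j p.1}.indicator (fun p => F p.2) (x, y) ∂μ
        = ∫⁻ x in E, (S.coset j y).indicator (fun _ => F y) x ∂μ := by
      refine lintegral_congr fun x => ?_
      by_cases h : y ∈ S.coset j x
      · rw [Set.indicator_of_mem (S.mem_coset_comm.1 h)]
        exact Set.indicator_of_mem (s := {p : G × G | p.2 ∈ S.coset j p.1}) h _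
      · rw [Set.indicator_of_notMem (fun h' => h (S.mem_coset_comm.1 h'))]
        exact Set.indicator_of_notMem (s := {p : G × G | p.2 ∈ S.coset j p.1}) h _
    rw [key, lintegral_indicator (S.measurableSet_coset j y), lintegral_const,
      Measure.restrict_apply_univ, Measure.restrict_apply (S.measurableSet_coset j y)]
    by_cases hy : y ∈ E
    · rw [Set.indicator_of_mem hy, mul_comm]
      gcongr
      exact (measure_mono Set.inter_subset_left).trans (S.measure_coset_le j y)
    · rw [Set.indicator_of_notMem hy]
      have : S.coset j y ∩ E = ∅ := by
        ext x
        simp only [Set.mem_inter_iff, Set.mem_empty_iff_false, iff_false, not_and]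
        exact fun hx hxE => hy (hinv x hxE (S.mem_coset_comm.1 hx))
      simp [this]
  · exact ((hF.comp measurable_snd).indicator (S.measurableSet_coset_prod j)).aemeasurable

/-- Weak type (1,1). Sorting the points by their largest bad scale j ≤ N gives disjoint sets E_j,
each a union of cosets of V_j, on which averaging loses nothing. The cutoff N ensures that a largest
scale exists; it is removed by monotone convergence. -/
lemma mul_measure_lt_cosetIntegral_le {F : G → ℝ≥0∞} (hF : Measurable F) (t : ℝ≥0∞) :
    t * μ {x | ∃ j : ℤ, t * Λ ^ (j : ℝ) < S.cosetIntegral F j x} ≤ ∫⁻ x, F x ∂μ := by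
  let bad (j : ℤ) : Set G := {x | t * Λ ^ (j : ℝ) < S.cosetIntegral F j x}
  have hbad_meas (j : ℤ) : MeasurableSet (bad j) :=
    measurableSet_lt measurable_const (S.measurable_cosetIntegral hF j)
  -- Badness at scale j depends only on the coset of V_j, hence is constant on the smaller cosets.
  have hbad_inv {i j : ℤ} (hij : i ≤ j) {x y : G} (hy : y ∈ S.coset i x) :
      y ∈ bad j ↔ x ∈ bad j := by
    simp only [bad, Set.mem_ofPred_eq, cosetIntegral, S.coset_eq (S.coset_mono hij x hy)]
  have hset : {x | ∃ j : ℤ, t * Λ ^ (j : ℝ) < S.cosetIntegral F j x} =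
      ⋃ N : ℕ, {x | ∃ j : ℤ, j ≤ N ∧ x ∈ bad j} := by
    ext x
    simp only [Set.mem_ofPred_eq, Set.mem_iUnion]
    constructor
    · rintro ⟨j, hj⟩
      exact ⟨j.toNat, j, Int.self_le_toNat j, hj⟩
    · rintro ⟨N, j, -, hj⟩
      exact ⟨j, hj⟩
  rw [hset, Monotone.measure_iUnion, ENNReal.mul_iSup]
  swap
  · rintro M N hMN x ⟨j, hj, hx⟩
    exact ⟨j, hj.trans (by exact_mod_cast hMN), hx⟩
  refine iSup_le fun N => ?_
  let E (j : ℤ) : Set G := if j ≤ N then bad j \ ⋃ i : Set.Ioc j (N : ℤ), bad i else ∅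
  have hE_meas (j : ℤ) : MeasurableSet (E j) := by
    simp only [E]
    split_ifs
    · exact (hbad_meas j).diff (MeasurableSet.iUnion fun i => hbad_meas i)
    · exact MeasurableSet.empty
  have hE_mem {j : ℤ} {x : G} : x ∈ E j ↔ j ≤ N ∧ x ∈ bad j ∧ ∀ i, j < i → i ≤ N → x ∉ bad i := by
    by_cases hj : j ≤ N <;> simp [E, hj]
  have hE_disj : Pairwise (Function.onFun Disjoint E) := by
    have aux {i j : ℤ} (hij : i < j) : Disjoint (E i) (E j) :=
      Set.disjoint_left.2 fun x hi hj =>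
        (hE_mem.1 hi).2.2 j hij (hE_mem.1 hj).1 (hE_mem.1 hj).2.1
    intro i j hij
    rcases hij.lt_or_gt with h | h
    exacts [aux h, (aux h).symm]
  have hE_inv (j : ℤ) : ∀ x ∈ E j, S.coset j x ⊆ E j := by
    intro x hx y hy
    obtain ⟨h1, h2, h3⟩ := hE_mem.1 hx
    exact hE_mem.2 ⟨h1, (hbad_inv le_rfl hy).2 h2,
      fun i hi hiN h => h3 i hi hiN ((hbad_inv hi.le hy).1 h)⟩
  have hE_union : {x | ∃ j : ℤ, j ≤ N ∧ x ∈ bad j} ⊆ ⋃ j, E j := by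
    rintro x ⟨j, hj⟩
    obtain ⟨m, hm, hmax⟩ := Int.exists_greatest_of_bdd (P := fun j : ℤ => j ≤ N ∧ x ∈ bad j)
      ⟨N, fun z hz => hz.1⟩ ⟨j, hj⟩
    refine Set.mem_iUnion.2 ⟨m, hE_mem.2 ⟨hm.1, hm.2, fun i hi hiN h => ?_⟩⟩
    exact absurd (hmax i ⟨hiN, h⟩) (not_le.2 hi)
  have hE_le (j : ℤ) : t * μ (E j) ≤ ∫⁻ x in E j, F x ∂μ := by
    have h0 := rpow_ne_zero_of_one_lt S.one_lt S.ne_top (j : ℝ)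
    have ht := rpow_ne_top_of_one_lt S.one_lt S.ne_top (j : ℝ)
    rw [← ENNReal.mul_le_mul_iff_right h0 ht]
    refine le_trans ?_ (S.lintegral_cosetIntegral_le hF (hE_meas j) (hE_inv j))
    rw [← mul_assoc, ← setLIntegral_const]
    refine setLIntegral_mono (S.measurable_cosetIntegral hF j) fun x hx => ?_
    rw [mul_comm]
    exact (hE_mem.1 hx).2.1.le
  calc t * μ {x | ∃ j : ℤ, j ≤ N ∧ x ∈ bad j}
      ≤ t * ∑' j, μ (E j) := by
        gcongr
        exact (measure_mono hE_union).trans (measure_iUnion_le _)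
    _ = ∑' j, t * μ (E j) := ENNReal.tsum_mul_left.symm
    _ ≤ ∑' j, ∫⁻ x in E j, F x ∂μ := ENNReal.tsum_le_tsum hE_le
    _ = ∫⁻ x in ⋃ j, E j, F x ∂μ := (lintegral_iUnion hE_meas hE_disj F).symm
    _ ≤ ∫⁻ x, F x ∂μ := setLIntegral_le_lintegral _ _

/-- Marcinkiewicz truncation: the part of F below t/2 contributes at most (t/2)Λ^j to any coset
integral, so the large part must exceed t/2 and the weak type bound applies to it. -/
lemma mul_measure_lt_maximal_le {F : G → ℝ≥0∞} (hF : Measurable F) (t : ℝ≥0∞) :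
    t * μ {x | t < S.maximal F x} ≤ 2 * ∫⁻ x in {x | t ≤ 2 * F x}, F x ∂μ := by
  have hm : MeasurableSet {x | t ≤ 2 * F x} := measurableSet_le measurable_const (hF.const_mul 2)
  have hF' : Measurable ({x | t ≤ 2 * F x}.indicator F) := hF.indicator hm
  have hsub : {x | t < S.maximal F x} ⊆
      {x | ∃ j : ℤ, (t / 2) * Λ ^ (j : ℝ) <
        S.cosetIntegral ({x | t ≤ 2 * F x}.indicator F) j x} := by
    intro x hx
    obtain ⟨j, hj⟩ := lt_iSup_iff.1 (show t < S.maximal F x from hx)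
    refine ⟨j, ?_⟩
    by_contra! hc
    refine absurd hj (not_lt.2 ?_)
    have hle : S.cosetIntegral F j x ≤
        (t / 2) * Λ ^ (j : ℝ) + S.cosetIntegral ({x | t ≤ 2 * F x}.indicator F) j x := by
      calc S.cosetIntegral F j x
          ≤ ∫⁻ y in S.coset j x, (t / 2 + {x | t ≤ 2 * F x}.indicator F y) ∂μ := by
            refine lintegral_mono fun y => ?_
            by_cases hy : t ≤ 2 * F y
            · rw [Set.indicator_of_mem (by exact hy)]
              exact le_add_self
            · rw [Set.indicator_of_notMem (by exact hy), add_zero,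
                ENNReal.le_div_iff_mul_le (by simp) (by simp), mul_comm]
              exact (not_le.1 hy).le
        _ ≤ _ := by
            rw [lintegral_add_left measurable_const, setLIntegral_const]
            gcongr
            · exact S.measure_coset_le j x
            · rfl
    calc Λ ^ (-(j : ℝ)) * S.cosetIntegral F j x
        ≤ Λ ^ (-(j : ℝ)) * ((t / 2) * Λ ^ (j : ℝ) + (t / 2) * Λ ^ (j : ℝ)) := by
          gcongr
          exact hle.trans (by gcongr)
      _ = (Λ ^ (-(j : ℝ)) * Λ ^ (j : ℝ)) * (t / 2 + t / 2) := by ring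
      _ = t := by rw [rpow_neg_mul_rpow_self S.one_lt S.ne_top, ENNReal.add_halves, one_mul]
  calc t * μ {x | t < S.maximal F x}
      = 2 * ((t / 2) * μ {x | t < S.maximal F x}) := by
        rw [← mul_assoc, ENNReal.mul_div_cancel (by simp) (by simp)]
    _ ≤ 2 * ∫⁻ x, {x | t ≤ 2 * F x}.indicator F x ∂μ := by
        gcongr
        refine le_trans ?_ (S.mul_measure_lt_cosetIntegral_le hF' (t / 2))
        gcongr
    _ = _ := by rw [lintegral_indicator hm]

/-- The strong type `(p, p)` maximal inequality. -/
lemma exists_lintegral_maximal_rpow_le {p : ℝ} (hp : 1 < p) :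
    ∃ C : ℝ≥0∞, C ≠ ⊤ ∧ ∀ F : G → ℝ≥0∞, Measurable F →
      ∫⁻ x, S.maximal F x ^ p ∂μ ≤ C * ∫⁻ x, F x ^ p ∂μ := by
  have h1 := S.one_lt
  have htop := S.ne_top
  obtain ⟨C, hC, hgeom⟩ := exists_tsum_rpow_le h1 htop (ε := p - 1) (by linarith)
  refine ⟨Λ ^ p * 2 * C * 2 ^ (p - 1), ?_, fun F hF => ?_⟩
  · exact ENNReal.mul_ne_top (ENNReal.mul_ne_top (ENNReal.mul_ne_top
      (rpow_ne_top_of_one_lt h1 htop p) (by simp)) hC) (by simp)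
  have hM := S.measurable_maximal hF
  have hset (j : ℤ) : MeasurableSet {x | Λ ^ (j : ℝ) < S.maximal F x} :=
    measurableSet_lt measurable_const hM
  have hset' (j : ℤ) : MeasurableSet {x | Λ ^ (j : ℝ) ≤ 2 * F x} :=
    measurableSet_le measurable_const (hF.const_mul 2)
  -- Layer cake over the levels Λ^j; after the truncated weak bound and an exchange of sum and
  -- integral, the inner geometric series stops at 2F(x) and has size F(x)^(p-1).
  calc ∫⁻ x, S.maximal F x ^ p ∂μ
      ≤ ∫⁻ x, ∑' j : ℤ, {x | Λ ^ (j : ℝ) < S.maximal F x}.indicator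
          (fun _ => Λ ^ (((j : ℝ) + 1) * p)) x ∂μ := by
        refine lintegral_mono fun x => ?_
        refine (rpow_le_tsum_layers h1 htop (by linarith : 0 < p) _).trans_eq ?_
        simp [Set.indicator]
    _ = ∑' j : ℤ, Λ ^ (((j : ℝ) + 1) * p) * μ {x | Λ ^ (j : ℝ) < S.maximal F x} := by
        rw [lintegral_tsum fun j => (measurable_const.indicator (hset j)).aemeasurable]
        refine tsum_congr fun j => ?_
        rw [lintegral_indicator (hset j), setLIntegral_const]
    _ ≤ ∑' j : ℤ, Λ ^ p * 2 * ∫⁻ x, {x | Λ ^ (j : ℝ) ≤ 2 * F x}.indicator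
          (fun x => Λ ^ ((j : ℝ) * (p - 1)) * F x) x ∂μ := by
        refine ENNReal.tsum_le_tsum fun j => ?_
        rw [lintegral_indicator (hset' j), lintegral_const_mul _ hF]
        have e : Λ ^ (((j : ℝ) + 1) * p) = Λ ^ p * Λ ^ ((j : ℝ) * (p - 1)) * Λ ^ (j : ℝ) := by
          rw [rpow_mul_rpow h1 htop, rpow_mul_rpow h1 htop]
          ring_nf
        calc _ = Λ ^ p * Λ ^ ((j : ℝ) * (p - 1)) *
              (Λ ^ (j : ℝ) * μ {x | Λ ^ (j : ℝ) < S.maximal F x}) := by rw [e]; ring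
          _ ≤ Λ ^ p * Λ ^ ((j : ℝ) * (p - 1)) *
              (2 * ∫⁻ x in {x | Λ ^ (j : ℝ) ≤ 2 * F x}, F x ∂μ) := by
            refine mul_le_mul_right ?_ _
            exact S.mul_measure_lt_maximal_le hF _
          _ = _ := by ring
    _ = Λ ^ p * 2 * ∫⁻ x, F x * ∑' j : ℤ,
          (if Λ ^ (j : ℝ) ≤ 2 * F x then Λ ^ ((j : ℝ) * (p - 1)) else 0) ∂μ := by
        rw [ENNReal.tsum_mul_left, ← lintegral_tsum
          fun j => ((hF.const_mul _).indicator (hset' j)).aemeasurable]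
        congr 1
        refine lintegral_congr fun x => ?_
        rw [← ENNReal.tsum_mul_left]
        refine tsum_congr fun j => ?_
        by_cases h : Λ ^ (j : ℝ) ≤ 2 * F x <;> simp [Set.indicator, mul_comm]
    _ ≤ Λ ^ p * 2 * ∫⁻ x, F x * (C * (2 * F x) ^ (p - 1)) ∂μ := by
        gcongr with x
        exact hgeom _
    _ = _ := by
        rw [mul_assoc (Λ ^ p * 2), mul_assoc (Λ ^ p * 2), ← lintegral_const_mul _ (hF.pow_const p)]
        congr 1
        refine lintegral_congr fun x => ?_
        have : F x ^ p = F x * F x ^ (p - 1) := by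
          nth_rw 2 [← ENNReal.rpow_one (F x)]
          rw [← ENNReal.rpow_add_of_nonneg _ _ zero_le_one (by linarith)]
          ring_nf
        rw [this, ENNReal.mul_rpow_of_nonneg _ _ (by linarith)]
        ring

end SubgroupScale

/-! ### Shells, the gauge and the Stein-Weiss kernel -/

namespace SubgroupScale

variable {G : Type*} [Group G] [MeasurableSpace G] {μ : Measure G} {Λ : ℝ≥0∞}
  (S : SubgroupScale μ Λ)

/-- The difference `V_n \ V_{n-1}`. -/
def shell (n : ℤ) : Set G := (S.V n : Set G) \ S.V (n - 1)

/-- The function equal to `Λ ^ n` on `V_n \ V_{n-1}`. -/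
def gauge (x : G) : ℝ≥0∞ := ⨅ (n : ℤ) (_ : x ∈ S.V n), Λ ^ (n : ℝ)

lemma mem_of_mem_shell {m n : ℤ} {x : G} (h : x ∈ S.shell m) : x ∈ S.V n ↔ m ≤ n := by
  refine ⟨fun hn => ?_, fun hmn => S.mono hmn h.1⟩
  by_contra! hlt
  exact h.2 (S.mono (by omega : n ≤ m - 1) hn)

lemma gauge_eq {n : ℤ} {x : G} (h : x ∈ S.shell n) : S.gauge x = Λ ^ (n : ℝ) := by
  refine le_antisymm (iInf₂_le n h.1) (le_iInf₂ fun m hm => ?_)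
  exact ENNReal.rpow_le_rpow_of_exponent_le S.one_lt.le
    (by exact_mod_cast (S.mem_of_mem_shell h).1 hm)

lemma measurableSet_shell (n : ℤ) : MeasurableSet (S.shell n) :=
  (S.measurableSet n).diff (S.measurableSet (n - 1))

lemma exists_mem_shell {x : G} (hx : x ≠ 1) : ∃ n, x ∈ S.shell n := by
  obtain ⟨m, hm⟩ := S.exists_notMem x hx
  obtain ⟨n, hn, hmin⟩ := Int.exists_least_of_bdd (P := fun n => x ∈ S.V n)
    ⟨m, fun z hz => by
      by_contra! h
      exact hm (S.mono h.le hz)⟩ (S.exists_mem x)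
  exact ⟨n, hn, fun h => absurd (hmin _ h) (by omega)⟩

lemma pairwise_disjoint_shell : Pairwise (Function.onFun Disjoint S.shell) := by
  intro m n hmn
  refine Set.disjoint_left.2 fun x hm hn => hmn (le_antisymm ?_ ?_)
  exacts [(S.mem_of_mem_shell hm).1 hn.1, (S.mem_of_mem_shell hn).1 hm.1]

/-- The ultrametric isosceles property: off the diagonal shells the kernel depends only on the two
shell indices. -/
lemma gauge_eq_of_mem {m n : ℤ} {x y : G} (hx : x ∈ S.shell n) (hy : y ∈ S.shell m)
    (hmn : m < n) : S.gauge (y⁻¹ * x) = Λ ^ (n : ℝ) := by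
  refine S.gauge_eq ⟨?_, fun h => hx.2 ?_⟩
  · exact mul_mem (inv_mem (S.mono hmn.le hy.1)) hx.1
  · have := mul_mem (S.mono (by omega : m ≤ n - 1) hy.1) h
    simpa using this

lemma gauge_eq_of_mem' {m n : ℤ} {x y : G} (hx : x ∈ S.shell n) (hy : y ∈ S.shell m)
    (hmn : n < m) : S.gauge (y⁻¹ * x) = Λ ^ (m : ℝ) := by
  refine S.gauge_eq ⟨?_, fun h => hy.2 ?_⟩
  · exact mul_mem (inv_mem hy.1) (S.mono hmn.le hx.1)
  · have := mul_mem (S.mono (by omega : n ≤ m - 1) hx.1) (inv_mem h)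
    simpa using this

/-- The Stein-Weiss kernel of the gauge. -/
def kernel (a b l : ℝ) (x y : G) : ℝ≥0∞ :=
  S.gauge x ^ (-a) * S.gauge y ^ (-b) * S.gauge (y⁻¹ * x) ^ (-l)

/-- The integral of `F` over the shell `V_n \ V_{n-1}`. -/
def shellIntegral (F : G → ℝ≥0∞) (n : ℤ) : ℝ≥0∞ := ∫⁻ y in S.shell n, F y ∂μ

/-- One term of one series already equals the left side: the shell of y lies below, above or at that
of x. In the last case y⁻¹x lies in the shell n - k for some k ≥ 0, which puts y in xV_{n-k}. -/
lemma kernel_mul_le {a b l : ℝ} {n : ℤ} {x y : G} (hx : x ∈ S.shell n) (hy : y ≠ 1) (hyx : y ≠ x)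
    (F : G → ℝ≥0∞) :
    S.kernel a b l x y * F y ≤
      (∑' k : ℕ, (S.shell (n - k)).indicator
        (fun y => Λ ^ (-(n : ℝ) * (a + l) - ((n : ℝ) - k) * b) * F y) y) +
      (∑' k : ℕ, (S.shell (n + k)).indicator
        (fun y => Λ ^ (-(n : ℝ) * a - ((n : ℝ) + k) * (b + l)) * F y) y) +
      ∑' k : ℕ, (S.coset (n - k) x).indicator
        (fun y => Λ ^ (-(n : ℝ) * (a + b) - ((n : ℝ) - k) * l) * F y) y := by
  have h1 := S.one_lt
  have htop := S.ne_top
  obtain ⟨m, hm⟩ := S.exists_mem_shell hy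
  rw [kernel, S.gauge_eq hx, S.gauge_eq hm]
  rcases lt_trichotomy m n with hmn | rfl | hmn
  · obtain ⟨k, rfl⟩ : ∃ k : ℕ, m = n - k := ⟨(n - m).toNat, by omega⟩
    refine le_trans ?_ (le_self_add.trans le_self_add)
    refine le_trans (le_of_eq ?_) (ENNReal.le_tsum k)
    rw [Set.indicator_of_mem hm, S.gauge_eq_of_mem hx hm hmn]
    simp only [← ENNReal.rpow_mul, rpow_mul_rpow h1 htop]
    push_cast
    ring_nf
  · obtain ⟨p, hp⟩ := S.exists_mem_shell (x := y⁻¹ * x) (by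
      rw [Ne, inv_mul_eq_one]; exact hyx)
    have hpm : p ≤ m := (S.mem_of_mem_shell hp).1 (mul_mem (inv_mem hm.1) hx.1)
    obtain ⟨k, rfl⟩ : ∃ k : ℕ, p = m - k := ⟨(m - p).toNat, by omega⟩
    refine le_trans ?_ le_add_self
    refine le_trans (le_of_eq ?_) (ENNReal.le_tsum k)
    rw [Set.indicator_of_mem (S.mem_coset_comm.2 hp.1), S.gauge_eq hp]
    simp only [← ENNReal.rpow_mul, rpow_mul_rpow h1 htop]
    push_cast
    ring_nf
  · obtain ⟨k, rfl⟩ : ∃ k : ℕ, m = n + k := ⟨(m - n).toNat, by omega⟩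
    refine le_trans ?_ (le_add_self.trans le_self_add)
    refine le_trans (le_of_eq ?_) (ENNReal.le_tsum k)
    rw [Set.indicator_of_mem hm, S.gauge_eq_of_mem' hx hm hmn]
    simp only [← ENNReal.rpow_mul, rpow_mul_rpow h1 htop]
    push_cast
    ring_nf

lemma lintegral_shell_le {F : G → ℝ≥0∞} (hF : Measurable F) {r : ℝ} (hr : 1 < r) (n : ℤ) :
    S.shellIntegral F n ≤
      Λ ^ ((n : ℝ) * (1 - 1 / r)) * (∫⁻ y in S.shell n, F y ^ r ∂μ) ^ (1 / r) := by
  refine (lintegral_rpow_le_measure_mul _ hr hF.aemeasurable).trans ?_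
  rw [Measure.restrict_apply_univ, ENNReal.rpow_mul]
  gcongr
  · rw [sub_nonneg, div_le_one (by linarith)]
    exact hr.le
  · exact (measure_mono Set.sdiff_subset).trans (S.measure_le n)

lemma tsum_lintegral_shell_le (F : G → ℝ≥0∞) :
    ∑' n, ∫⁻ y in S.shell n, F y ∂μ ≤ ∫⁻ y, F y ∂μ := by
  rw [← lintegral_iUnion S.measurableSet_shell S.pairwise_disjoint_shell]
  exact setLIntegral_le_lintegral _ _

variable [MeasurableMul₂ G] [μ.IsMulLeftInvariant]

/-- Points are null because xV_j has measure at most Λ^j, which tends to 0 as j → -∞. -/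
lemma ae_ne (S : SubgroupScale μ Λ) (x : G) : ∀ᵐ y ∂μ, y ≠ x := by
  have h1 := S.one_lt
  have h (j : ℤ) : μ {x} ≤ Λ ^ j := by
    rw [← ENNReal.rpow_intCast]
    refine (measure_mono ?_).trans (S.measure_coset_le j x)
    simp [coset]
  rw [ae_iff]
  simp only [ne_eq, not_not, Set.ofPred_eq_eq_singleton]
  by_contra h0
  obtain ⟨n, hn, -⟩ := ENNReal.exists_mem_Ico_zpow h0
    ((h 0).trans_lt (by simp)).ne h1 S.ne_top
  refine absurd (hn.trans (h (n - 1))) (not_le.2 ?_)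
  rw [← ENNReal.rpow_intCast, ← ENNReal.rpow_intCast]
  exact ENNReal.rpow_lt_rpow_of_exponent_lt h1 S.ne_top (by push_cast; linarith)

lemma lintegral_eq_tsum_shell (g : G → ℝ≥0∞) :
    ∫⁻ x, g x ∂μ = ∑' n, ∫⁻ x in S.shell n, g x ∂μ := by
  rw [← lintegral_iUnion S.measurableSet_shell S.pairwise_disjoint_shell, ← setLIntegral_univ]
  refine setLIntegral_congr (Filter.EventuallyEq.symm ?_)
  rw [ae_eq_univ, ← mem_ae_iff]
  filter_upwards [S.ae_ne 1] with x hx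
  exact Set.mem_iUnion.2 (S.exists_mem_shell hx)

lemma lintegral_kernel_mul_le (a b l : ℝ) {n : ℤ} {x : G} (hx : x ∈ S.shell n)
    {F : G → ℝ≥0∞} (hF : Measurable F) :
    ∫⁻ y, S.kernel a b l x y * F y ∂μ ≤
      (∑' k : ℕ, Λ ^ (-(n : ℝ) * (a + l) - ((n : ℝ) - k) * b) * S.shellIntegral F (n - k)) +
      (∑' k : ℕ, Λ ^ (-(n : ℝ) * a - ((n : ℝ) + k) * (b + l)) * S.shellIntegral F (n + k)) +
      ∑' k : ℕ, Λ ^ (-(n : ℝ) * (a + b) - ((n : ℝ) - k) * l) * S.cosetIntegral F (n - k) x := by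
  have hmeas {A : ℕ → Set G} (hA : ∀ k, MeasurableSet (A k)) (c : ℕ → ℝ≥0∞) (k : ℕ) :
      Measurable ((A k).indicator fun y => c k * F y) :=
    (hF.const_mul _).indicator (hA k)
  have hsum {A : ℕ → Set G} (hA : ∀ k, MeasurableSet (A k)) (c : ℕ → ℝ≥0∞) :
      ∫⁻ y, ∑' k, (A k).indicator (fun y => c k * F y) y ∂μ = ∑' k, c k * ∫⁻ y in A k, F y ∂μ := by
    rw [lintegral_tsum fun k => (hmeas hA c k).aemeasurable]
    refine tsum_congr fun k => ?_
    rw [lintegral_indicator (hA k), lintegral_const_mul _ hF]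
  have hA₁ := fun k : ℕ => S.measurableSet_shell (n - k)
  have hA₂ := fun k : ℕ => S.measurableSet_shell (n + k)
  have hA₃ := fun k : ℕ => S.measurableSet_coset (n - k) x
  have hae := ((S.ae_ne 1).and (S.ae_ne x)).mono fun y hy =>
    S.kernel_mul_le (a := a) (b := b) (l := l) hx hy.1 hy.2 F
  refine (lintegral_mono_ae hae).trans (le_of_eq ?_)
  rw [lintegral_add_left, lintegral_add_left, hsum hA₁, hsum hA₂, hsum hA₃]
  · rfl
  · exact Measurable.tsum (hmeas hA₁ _)
  · exact (Measurable.tsum (hmeas hA₁ _)).add (Measurable.tsum (hmeas hA₂ _))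

lemma cosetIntegral_le {F : G → ℝ≥0∞} (hF : Measurable F) {r : ℝ} (hr : 1 < r) (j : ℤ) (x : G) :
    S.cosetIntegral F j x ≤ Λ ^ ((j : ℝ) * (1 - 1 / r)) * (∫⁻ y, F y ^ r ∂μ) ^ (1 / r) := by
  refine (lintegral_rpow_le_measure_mul _ hr hF.aemeasurable).trans ?_
  rw [Measure.restrict_apply_univ, ENNReal.rpow_mul]
  gcongr
  · rw [sub_nonneg, div_le_one (by linarith)]
    exact hr.le
  · exact S.measure_coset_le j x
  · exact Measure.restrict_le_self

/-- Hedberg's pointwise estimate of the diagonal part of the kernel. -/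
lemma exists_diagonal_le {a b l r s : ℝ} (hl : l < 1) (hr : 1 < r) (hrs : r ≤ s)
    (hab : 0 ≤ a + b) (hscale : 1 / s = 1 / r + (a + b + l) - 1) :
    ∃ C : ℝ≥0∞, C ≠ ⊤ ∧ ∀ F : G → ℝ≥0∞, Measurable F → ∀ (n : ℤ) (x : G),
      ∑' k : ℕ, Λ ^ (-(n : ℝ) * (a + b) - ((n : ℝ) - k) * l) * S.cosetIntegral F (n - k) x ≤
        C * (S.maximal F x ^ (r / s) * ((∫⁻ y, F y ^ r ∂μ) ^ (1 / r)) ^ (1 - r / s)) := by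
  have h1 := S.one_lt
  have htop := S.ne_top
  have hr0 : 0 < r := by linarith
  have hs0 : 0 < s := by linarith
  rcases hrs.eq_or_lt with rfl | hlt
  -- For r = s the scaling relation forces a + b + l = 1, and the maximal bound alone gives a series
  -- convergent because l < 1.
  · refine ⟨∑' k : ℕ, Λ ^ (-((k : ℝ) * (1 - l))), tsum_rpow_neg_ne_top h1 (by linarith),
      fun F hF n x => ?_⟩
    rw [div_self hr0.ne', sub_self, ENNReal.rpow_zero, mul_one, ENNReal.rpow_one,
      ← ENNReal.tsum_mul_right]
    refine ENNReal.tsum_le_tsum fun k => ?_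
    calc _ ≤ Λ ^ (-(n : ℝ) * (a + b) - ((n : ℝ) - k) * l) *
          (Λ ^ ((n - k : ℤ) : ℝ) * S.maximal F x) := by
          gcongr
          exact S.cosetIntegral_le_maximal F _ x
      _ = _ := by
          rw [← mul_assoc, rpow_mul_rpow h1 htop]
          have : a + b = 1 - l := by linarith
          rw [this]
          push_cast
          ring_nf
  -- For r < s the maximal bound grows like Λ^(j(1/r - 1/s)) and the Hölder bound decays like
  -- Λ^(-j/s); summing the smaller one gives the exponents r/s and 1 - r/s.
  · have hσ : 0 < 1 / r - 1 / s := sub_pos.2 (one_div_lt_one_div_of_lt hr0 hlt)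
    obtain ⟨C, hC, hbound⟩ := exists_tsum_le_of_le_of_le h1 htop hσ (one_div_pos.2 hs0)
    refine ⟨C, hC, fun F hF n x => ?_⟩
    have e1 : 1 / s / (1 / r - 1 / s + 1 / s) = r / s := by rw [sub_add_cancel]; field_simp
    have e2 : (1 / r - 1 / s) / (1 / r - 1 / s + 1 / s) = 1 - r / s := by
      rw [sub_add_cancel]; field_simp
    rw [← e2, ← e1]
    -- Since a + b ≥ 0, the factor Λ^(-n(a+b)) may be replaced by the larger Λ^(-(n-k)(a+b)),
    -- leaving a series in j = n - k only.
    refine le_trans ?_ (hbound _ _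
      (fun j : ℤ => Λ ^ (-(j : ℝ) * (a + b + l)) * S.cosetIntegral F j x)
      (fun j => ?_) fun j => ?_)
    · have hinj : Function.Injective fun k : ℕ => n - (k : ℤ) := fun i j h => by
        simp only at h; omega
      refine le_trans ?_ (ENNReal.tsum_comp_le_tsum_of_injective hinj _)
      refine ENNReal.tsum_le_tsum fun k => ?_
      gcongr
      · exact h1.le
      · push_cast
        nlinarith [mul_nonneg (Nat.cast_nonneg (α := ℝ) k) hab]
    · refine (mul_le_mul_right (S.cosetIntegral_le_maximal F j x) _).trans (le_of_eq ?_)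
      rw [← mul_assoc, rpow_mul_rpow h1 htop, hscale]
      ring_nf
    · refine (mul_le_mul_right (S.cosetIntegral_le hF hr j x) _).trans (le_of_eq ?_)
      rw [← mul_assoc, rpow_mul_rpow h1 htop, hscale]
      ring_nf

variable [MeasurableInv G] [SFinite μ]

/-- The Stein-Weiss inequality for the gauge. -/
theorem exists_lintegral_kernel_rpow_le {a b l r s : ℝ} (hl : l < 1) (hr : 1 < r)
    (hrs : r ≤ s) (hb : b < 1 - 1 / r) (ha : a < 1 / s) (hab : 0 ≤ a + b)
    (hscale : 1 / s = 1 / r + (a + b + l) - 1) :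
    ∃ C : ℝ≥0∞, C ≠ ⊤ ∧ ∀ F : G → ℝ≥0∞, Measurable F →
      ∫⁻ x, (∫⁻ y, S.kernel a b l x y * F y ∂μ) ^ s ∂μ ≤
        C * (∫⁻ y, F y ^ r ∂μ) ^ (s / r) := by
  have h1 := S.one_lt
  have htop := S.ne_top
  have hr0 : 0 < r := by linarith
  have hs1 : 1 < s := by linarith
  have hs0 : 0 < s := by linarith
  obtain ⟨CD, hCD, hD⟩ := S.exists_diagonal_le hl hr hrs hab hscale
  obtain ⟨CM, hCM, hM⟩ := S.exists_lintegral_maximal_rpow_le hr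
  -- The ℓ¹ norms of the two off-diagonal convolution kernels, finite by b < 1 - 1/r and a < 1/s.
  set W₁ : ℝ≥0∞ := ∑' k : ℕ, Λ ^ (-((k : ℝ) * (1 - 1 / r - b))) with hW₁
  set W₂ : ℝ≥0∞ := ∑' k : ℕ, Λ ^ (-((k : ℝ) * (1 / s - a))) with hW₂
  have hW₁t : W₁ ≠ ⊤ := tsum_rpow_neg_ne_top h1 (by linarith)
  have hW₂t : W₂ ≠ ⊤ := tsum_rpow_neg_ne_top h1 (by linarith)
  refine ⟨3 ^ s * (W₁ ^ s + W₂ ^ s + CD ^ s * CM), ?_, fun F hF => ?_⟩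
  · have := ENNReal.rpow_ne_top_of_nonneg hs0.le hW₁t
    have := ENNReal.rpow_ne_top_of_nonneg hs0.le hW₂t
    have := ENNReal.rpow_ne_top_of_nonneg hs0.le hCD
    have : (3 : ℝ≥0∞) ^ s ≠ ⊤ := ENNReal.rpow_ne_top_of_nonneg hs0.le (by simp)
    finiteness
  set I : ℝ≥0∞ := ∫⁻ y, F y ^ r ∂μ with hI
  set φ : ℤ → ℝ≥0∞ := fun n => (∫⁻ y in S.shell n, F y ^ r ∂μ) ^ (1 / r) with hφ
  have hφr : ∑' n, φ n ^ r ≤ I := by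
    refine le_trans (le_of_eq (tsum_congr fun n => ?_)) (S.tsum_lintegral_shell_le _)
    rw [hφ, ← ENNReal.rpow_mul, one_div_mul_cancel hr0.ne', ENNReal.rpow_one]
  set γ₁ : ℤ → ℝ≥0∞ := fun n => ∑' k : ℕ, Λ ^ (-((k : ℝ) * (1 - 1 / r - b))) * φ (n - k) with hγ₁
  set γ₂ : ℤ → ℝ≥0∞ := fun n => ∑' k : ℕ, Λ ^ (-((k : ℝ) * (1 / s - a))) * φ (n + k) with hγ₂
  have hγ₁s : ∑' n, γ₁ n ^ s ≤ W₁ ^ s * I ^ (s / r) := by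
    refine (tsum_tsum_rpow_le hr0 hrs hs1 _ (fun k => Equiv.subRight (k : ℤ)) φ).trans ?_
    gcongr
  have hγ₂s : ∑' n, γ₂ n ^ s ≤ W₂ ^ s * I ^ (s / r) := by
    refine (tsum_tsum_rpow_le hr0 hrs hs1 _ (fun k => Equiv.addRight (k : ℤ)) φ).trans ?_
    gcongr
  -- By scaling, Hölder on the shell n ∓ k leaves Λ^(-n/s) times a term of γ₁ or γ₂; the s-th power
  -- of this factor cancels the measure of the shell.
  have hpt {n : ℤ} {x : G} (hx : x ∈ S.shell n) : ∫⁻ y, S.kernel a b l x y * F y ∂μ ≤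
      Λ ^ (-(n : ℝ) * (1 / s)) * γ₁ n + Λ ^ (-(n : ℝ) * (1 / s)) * γ₂ n +
        CD * (S.maximal F x ^ (r / s) * (I ^ (1 / r)) ^ (1 - r / s)) := by
    refine (S.lintegral_kernel_mul_le a b l hx hF).trans
      (add_le_add (add_le_add ?_ ?_) (hD F hF n x))
    · rw [hγ₁, ← ENNReal.tsum_mul_left]
      refine ENNReal.tsum_le_tsum fun k => ?_
      refine (mul_le_mul_right (S.lintegral_shell_le hF hr _) _).trans (le_of_eq ?_)
      rw [← mul_assoc, ← mul_assoc, rpow_mul_rpow h1 htop, rpow_mul_rpow h1 htop, hscale]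
      simp only [hφ]
      push_cast
      ring_nf
    · rw [hγ₂, ← ENNReal.tsum_mul_left]
      refine ENNReal.tsum_le_tsum fun k => ?_
      refine (mul_le_mul_right (S.lintegral_shell_le hF hr _) _).trans (le_of_eq ?_)
      rw [← mul_assoc, ← mul_assoc, rpow_mul_rpow h1 htop, rpow_mul_rpow h1 htop, hscale]
      simp only [hφ]
      push_cast
      ring_nf
  have hadd (X Y Z : ℝ≥0∞) : (X + Y + Z) ^ s ≤ 3 ^ s * (X ^ s + Y ^ s + Z ^ s) := by
    have hmax : X + Y + Z ≤ 3 * max X (max Y Z) := by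
      calc X + Y + Z ≤ max X (max Y Z) + max X (max Y Z) + max X (max Y Z) := by
            gcongr <;> simp
        _ = _ := by ring
    calc (X + Y + Z) ^ s ≤ (3 * max X (max Y Z)) ^ s := by gcongr
      _ = 3 ^ s * max X (max Y Z) ^ s := ENNReal.mul_rpow_of_nonneg _ _ hs0.le
      _ ≤ _ := by
        gcongr
        rcases max_choice X (max Y Z) with h | h <;> rw [h]
        · exact le_self_add.trans le_self_add
        · rcases max_choice Y Z with h | h <;> rw [h]
          · exact le_add_self.trans le_self_add
          · exact le_add_self
  have hshell (γ : ℤ → ℝ≥0∞) (n : ℤ) :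
      (Λ ^ (-(n : ℝ) * (1 / s)) * γ n) ^ s * μ (S.shell n) ≤ γ n ^ s := by
    rw [ENNReal.mul_rpow_of_nonneg _ _ hs0.le, ← ENNReal.rpow_mul, mul_assoc (-(n : ℝ)),
      one_div_mul_cancel hs0.ne', mul_one]
    calc _ ≤ Λ ^ (-(n : ℝ)) * γ n ^ s * Λ ^ (n : ℝ) := by
          gcongr
          exact (measure_mono Set.sdiff_subset).trans (S.measure_le n)
      _ = (Λ ^ (-(n : ℝ)) * Λ ^ (n : ℝ)) * γ n ^ s := by ring
      _ = γ n ^ s := by rw [rpow_neg_mul_rpow_self h1 htop, one_mul]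
  -- The s-th power turns the exponent r/s into r, where the maximal inequality applies.
  have hdiag (x : G) : (CD * (S.maximal F x ^ (r / s) * (I ^ (1 / r)) ^ (1 - r / s))) ^ s =
      CD ^ s * I ^ (s / r - 1) * S.maximal F x ^ r := by
    rw [ENNReal.mul_rpow_of_nonneg _ _ hs0.le, ENNReal.mul_rpow_of_nonneg _ _ hs0.le,
      ← ENNReal.rpow_mul, ← ENNReal.rpow_mul, ← ENNReal.rpow_mul, div_mul_cancel₀ _ hs0.ne',
      mul_assoc, mul_comm (I ^ _)]
    congr 3
    field_simp
  have hMmeas := S.measurable_maximal hF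
  calc ∫⁻ x, (∫⁻ y, S.kernel a b l x y * F y ∂μ) ^ s ∂μ
      = ∑' n, ∫⁻ x in S.shell n, (∫⁻ y, S.kernel a b l x y * F y ∂μ) ^ s ∂μ :=
        S.lintegral_eq_tsum_shell _
    _ ≤ ∑' n, ∫⁻ x in S.shell n, 3 ^ s * ((Λ ^ (-(n : ℝ) * (1 / s)) * γ₁ n) ^ s +
          (Λ ^ (-(n : ℝ) * (1 / s)) * γ₂ n) ^ s +
          CD ^ s * I ^ (s / r - 1) * S.maximal F x ^ r) ∂μ := by
        refine ENNReal.tsum_le_tsum fun n => ?_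
        refine setLIntegral_mono' (S.measurableSet_shell n) fun x hx => ?_
        rw [← hdiag]
        refine le_trans ?_ (hadd _ _ _)
        gcongr
        exact hpt hx
    _ ≤ ∑' n, 3 ^ s * (γ₁ n ^ s + γ₂ n ^ s +
          CD ^ s * I ^ (s / r - 1) * ∫⁻ x in S.shell n, S.maximal F x ^ r ∂μ) := by
        refine ENNReal.tsum_le_tsum fun n => ?_
        rw [lintegral_const_mul _ (by fun_prop), lintegral_add_left measurable_const,
          lintegral_const_mul _ (hMmeas.pow_const r), lintegral_const, Measure.restrict_apply_univ,
          add_mul]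
        gcongr
        exacts [hshell γ₁ n, hshell γ₂ n]
    _ ≤ 3 ^ s * (W₁ ^ s * I ^ (s / r) + W₂ ^ s * I ^ (s / r) +
          CD ^ s * I ^ (s / r - 1) * (CM * I)) := by
        rw [ENNReal.tsum_mul_left, ENNReal.tsum_add, ENNReal.tsum_add, ENNReal.tsum_mul_left]
        gcongr
        exact (S.tsum_lintegral_shell_le _).trans (hM F hF)
    _ = _ := by
        have : I ^ (s / r) = I ^ (s / r - 1) * I := by
          nth_rw 3 [← ENNReal.rpow_one I]
          rw [← ENNReal.rpow_add_of_nonneg _ _ (sub_nonneg.2 ((one_le_div hr0).2 hrs)) zero_le_one]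
          ring_nf
        rw [this]
        ring

end SubgroupScale

/-! ### Naturality of the Baker-Campbell-Hausdorff product -/

section Bch

lemma dynkinWord_map {L : Type*} (f : L → L) (X Y : L) {k : ℕ} (p : Fin k → ℕ × ℕ) :
    dynkinWord (f X) (f Y) p = (dynkinWord X Y p).map f := by
  simp [dynkinWord, List.map_flatten, List.map_ofFn, Function.comp_def]

variable {K L : Type*} [Field K] [LieRing L] [LieAlgebra K L]

lemma nestedBracket_map {f : L → L} (h0 : f 0 = 0) (hf : ∀ X Y, f ⁅X, Y⁆ = ⁅f X, f Y⁆) :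
    ∀ l : List L, nestedBracket (l.map f) = f (nestedBracket l)
  | [] => h0.symm
  | [_] => rfl
  | a :: b :: l => by
    have := nestedBracket_map h0 hf (b :: l)
    simp only [List.map_cons, nestedBracket, hf] at this ⊢
    rw [this]

lemma bchTerm_map (f : L →ₗ[K] L) (hf : ∀ X Y, f ⁅X, Y⁆ = ⁅f X, f Y⁆) (n : ℕ) (X Y : L) :
    bchTerm K n (f X) (f Y) = f (bchTerm K n X Y) := by
  simp only [bchTerm, map_sum, map_smul, dynkinWord_map f, nestedBracket_map (map_zero f) hf]

/-- Bijectivity of f lets it pass through `finsum` without any proof that the sum is finite. -/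
lemma bch_map (f : L ≃ₗ[K] L) (hf : ∀ X Y, f ⁅X, Y⁆ = ⁅f X, f Y⁆) (X Y : L) :
    bch K (f X) (f Y) = f (bch K X Y) := by
  have h := f.toAddEquiv.map_finsum fun n => bchTerm K n X Y
  simp only [bch]
  refine Eq.trans ?_ h.symm
  exact finsum_congr fun n => bchTerm_map f.toLinearMap hf n X Y

end Bch

/-! ### Dilations and the filtration in coordinates -/

namespace GradedLieGroup

namespace HomogeneousBasis

section Algebra

variable {K g G : Type*} [NontriviallyNormedField K] [LieRing g] [LieAlgebra K g]
  [TopologicalSpace g] [Group G] [TopologicalSpace G] {H : GradedLieGroup K g G} {d : ℕ}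
  (B : H.HomogeneousBasis d)

lemma repr_dilation (γ : K) (X : g) (i : Fin d) :
    B.basis.repr (B.dilation γ X) i = γ ^ B.weight i * B.basis.repr X i := by
  rw [dilation, Module.Basis.constr_apply_fintype]
  simp [Finsupp.single_apply, mul_comm]

lemma dilation_mul (γ δ : K) (X : g) :
    B.dilation (γ * δ) X = B.dilation γ (B.dilation δ X) := by
  apply B.basis.repr.injective
  ext i
  simp only [repr_dilation, mul_pow, mul_assoc]

lemma dilation_one (X : g) : B.dilation 1 X = X := by
  apply B.basis.repr.injective
  ext i
  simp [repr_dilation]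

lemma one_le_weight (i : Fin d) : 1 ≤ B.weight i := by
  rw [Nat.one_le_iff_ne_zero]
  intro h
  have := B.basis_mem i
  rw [h, H.V_zero, Submodule.mem_bot] at this
  exact B.basis.ne_zero i this

/-- The components of X of weight other than k sum to an element of V_k that also lies in the span
of the other layers; it vanishes because the sum is direct. -/
lemma repr_eq_zero {k : ℕ} {X : g} (hX : X ∈ H.V k) {i : Fin d} (hi : B.weight i ≠ k) :
    B.basis.repr X i = 0 := by
  classical
  set Z : g := ∑ j ∈ Finset.univ.filter (fun j => B.weight j ≠ k), B.basis.repr X j • B.basis j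
    with hZ
  have hsum : X = (∑ j ∈ Finset.univ.filter (fun j => B.weight j = k),
      B.basis.repr X j • B.basis j) + Z := by
    rw [hZ, Finset.sum_filter_add_sum_filter_not, B.basis.sum_repr]
  have hZ₁ : Z ∈ H.V k := by
    rw [eq_sub_iff_add_eq'.2 hsum.symm]
    refine sub_mem hX (sum_mem fun j hj => Submodule.smul_mem _ _ ?_)
    rw [← (Finset.mem_filter.1 hj).2]
    exact B.basis_mem j
  have hZ₂ : Z ∈ ⨆ m, ⨆ (_ : m ≠ k), H.V m := by
    refine sum_mem fun j hj => Submodule.smul_mem _ _ ?_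
    exact Submodule.mem_iSup_of_mem (B.weight j)
      (Submodule.mem_iSup_of_mem (Finset.mem_filter.1 hj).2 (B.basis_mem j))
  have hZ0 : Z = 0 :=
    Submodule.disjoint_def.1 (H.isInternal.submodule_iSupIndep k) Z hZ₁ hZ₂
  have := (Fintype.linearIndependent_iff.1 B.basis.linearIndependent)
    (fun j => if B.weight j ≠ k then B.basis.repr X j else 0) (by
      simpa [hZ, Finset.sum_filter, ite_smul] using hZ0) i
  simpa [hi] using this

lemma dilation_of_mem (γ : K) {k : ℕ} {X : g} (hX : X ∈ H.V k) : B.dilation γ X = γ ^ k • X := by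
  apply B.basis.repr.injective
  ext i
  rw [repr_dilation, map_smul, Finsupp.smul_apply, smul_eq_mul]
  by_cases hi : B.weight i = k
  · rw [hi]
  · rw [B.repr_eq_zero hX hi, mul_zero, mul_zero]

/-- By bilinearity it suffices to take basis vectors, where it is γ^i γ^j = γ^(i+j) on [V_i, V_j] ⊆
V_{i+j}. -/
lemma dilation_lie (γ : K) (X Y : g) :
    B.dilation γ ⁅X, Y⁆ = ⁅B.dilation γ X, B.dilation γ Y⁆ := by
  have hX : X ∈ Submodule.span K (Set.range B.basis) := by simp [B.basis.span_eq]
  have hY : Y ∈ Submodule.span K (Set.range B.basis) := by simp [B.basis.span_eq]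
  induction hX using Submodule.span_induction with
  | zero => simp
  | add x y _ _ hx hy => simp [hx, hy]
  | smul a x _ hx => simp [hx]
  | mem x hx =>
    obtain ⟨i, rfl⟩ := hx
    induction hY using Submodule.span_induction with
    | zero => simp
    | add x y _ _ hx hy => simp [hx, hy]
    | smul a x _ hx => simp [hx]
    | mem y hy =>
      obtain ⟨j, rfl⟩ := hy
      rw [B.dilation_of_mem γ (H.lie_mem _ _ _ _ (B.basis_mem i) (B.basis_mem j)),
        B.dilation_of_mem γ (B.basis_mem i), B.dilation_of_mem γ (B.basis_mem j),
        smul_lie, lie_smul, smul_smul, pow_add]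

/-- The dilation by a nonzero scalar, as a linear equivalence. -/
def dilationLinearEquiv {γ : K} (hγ : γ ≠ 0) : g ≃ₗ[K] g :=
  LinearEquiv.ofLinearMap (B.dilation γ) (B.dilation γ⁻¹)
    (LinearMap.ext fun X => by simp [← dilation_mul, hγ, dilation_one])
    (LinearMap.ext fun X => by simp [← dilation_mul, hγ, dilation_one])

/-- The coordinates of a group element in the exponential chart. -/
def coord (x : G) (i : Fin d) : K := B.basis.repr (H.exp.symm x) i

lemma mem_filtration {ϖ : K} (hϖ : ϖ ≠ 0) {n : ℤ} {x : G} :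
    x ∈ B.filtration ϖ n ↔ ∀ i, ‖B.coord x i‖ ≤ (‖ϖ‖ ^ n) ^ B.weight i := by
  have hn : ϖ ^ n ≠ 0 := zpow_ne_zero n hϖ
  have hpos (i : Fin d) : 0 < (‖ϖ‖ ^ n) ^ B.weight i := by
    have := norm_pos_iff.2 hϖ
    positivity
  constructor
  · rintro ⟨-, ⟨X, hX, rfl⟩, rfl⟩ i
    rw [coord, Homeomorph.symm_apply_apply, repr_dilation, norm_mul, norm_pow, norm_zpow]
    exact mul_le_of_le_one_right (hpos i).le (hX i)
  · intro h
    refine ⟨H.exp.symm x, ⟨B.dilation (ϖ ^ n)⁻¹ (H.exp.symm x), fun i => ?_, ?_⟩, by simp⟩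
    · rw [repr_dilation, norm_mul, norm_pow, norm_inv, norm_zpow, inv_pow,
        inv_mul_le_iff₀ (hpos i), mul_one]
      exact h i
    · rw [← dilation_mul, mul_inv_cancel₀ hn, dilation_one]

lemma filtration_antitone {ϖ : K} (hϖ : IsUniformizer ϖ) : Antitone (B.filtration (G := G) ϖ) := by
  intro m n hmn x hx
  have h0 := norm_pos_iff.2 hϖ.ne_zero
  rw [B.mem_filtration hϖ.ne_zero] at hx ⊢
  intro i
  refine (hx i).trans (pow_le_pow_left₀ (by positivity) ?_ _)
  exact zpow_le_zpow_right_of_le_one₀ h0 hϖ.norm_lt_one.le hmn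

lemma exists_mem_filtration_zero_diff {ϖ : K} (hϖ : IsUniformizer ϖ) (hd : 0 < d) :
    ((B.filtration ϖ 0 : Set G) \ B.filtration ϖ 1).Nonempty := by
  let i : Fin d := ⟨0, hd⟩
  have hc (j : Fin d) : B.coord (H.exp (B.basis i) : G) j = if i = j then 1 else 0 := by
    simp [coord, Finsupp.single_apply]
  refine ⟨H.exp (B.basis i), (B.mem_filtration hϖ.ne_zero).2 fun j => ?_, fun h => ?_⟩
  · rw [hc]
    split_ifs <;> simp
  · have := (B.mem_filtration hϖ.ne_zero).1 h i
    rw [hc, if_pos rfl, norm_one, zpow_one] at this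
    exact not_lt.2 this (pow_lt_one₀ (norm_nonneg _) hϖ.norm_lt_one
      (by have := B.one_le_weight i; omega))

lemma quasiNorm_eq [MeasurableSpace G] {ϖ : K} (hϖ : IsUniformizer ϖ) (μ : Measure G) {χ : ℝ≥0}
    (hχ : ∀ n : ℤ, μ (B.filtration ϖ n) = (χ ^ n : ℝ≥0)) {n : ℤ} {x : G}
    (hx : x ∈ B.filtration ϖ n \ B.filtration ϖ (n + 1)) :
    B.quasiNorm ϖ μ x = ((χ : ℝ) ^ n) ^ (1 / (H.homDim : ℝ)) := by
  have h : ∃ n : ℤ, x ∈ B.filtration ϖ n \ B.filtration ϖ (n + 1) := ⟨n, hx⟩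
  have key {i j : ℤ} (hi : x ∈ B.filtration ϖ i) (hj : x ∉ B.filtration ϖ (j + 1)) : i ≤ j := by
    by_contra! hlt
    exact hj (B.filtration_antitone hϖ (by omega : j + 1 ≤ i) hi)
  have hn : h.choose = n :=
    le_antisymm (key h.choose_spec.1 hx.2) (key hx.1 h.choose_spec.2)
  rw [quasiNorm, dif_pos h, hn, measureReal_def, hχ]
  simp

end Algebra

/-! ### The exponential chart and topology of the filtration -/

section Topology

variable {K g G : Type*} [NontriviallyNormedField K] [LocallyCompactSpace K]
  [LieRing g] [LieAlgebra K g]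
  [TopologicalSpace g] [IsTopologicalAddGroup g] [ContinuousSMul K g] [T2Space g]
  [Group G] [TopologicalSpace G] {H : GradedLieGroup K g G} {d : ℕ}
  (B : H.HomogeneousBasis d)

/-- The exponential coordinates, as a homeomorphism onto `K ^ d`. -/
def chart : G ≃ₜ (Fin d → K) :=
  haveI : ProperSpace K := .of_locallyCompactSpace K
  H.exp.symm.trans B.basis.equivFunL.toHomeomorph

lemma chart_apply (x : G) (i : Fin d) : B.chart x i = B.coord x i := rfl

include B in
lemma secondCountableTopology : SecondCountableTopology G :=
  haveI : ProperSpace K := .of_locallyCompactSpace K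
  B.chart.secondCountableTopology

include B in
lemma t2Space : T2Space G := B.chart.symm.t2Space

include B in
lemma locallyCompactSpace : LocallyCompactSpace G := B.chart.isOpenEmbedding.locallyCompactSpace

/-- The dilation `exp ∘ D_γ ∘ exp⁻¹` of the group. -/
def groupDilation {γ : K} (hγ : γ ≠ 0) : G ≃ₜ* G :=
  haveI : ProperSpace K := .of_locallyCompactSpace K
  haveI : FiniteDimensional K g := .of_basis B.basis
  { toFun := fun x => H.exp (B.dilationLinearEquiv hγ (H.exp.symm x))
    invFun := fun x => H.exp ((B.dilationLinearEquiv hγ).symm (H.exp.symm x))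
    left_inv := fun x => by simp
    right_inv := fun x => by simp
    map_mul' := fun x y => by
      obtain ⟨X, rfl⟩ := H.exp.surjective x
      obtain ⟨Y, rfl⟩ := H.exp.surjective y
      simp only [H.exp_mul_exp, Homeomorph.symm_apply_apply]
      rw [bch_map _ (B.dilation_lie γ)]
    continuous_toFun := H.exp.continuous.comp
      ((LinearMap.continuous_of_finiteDimensional
        (B.dilationLinearEquiv hγ).toLinearMap).comp H.exp.symm.continuous)
    continuous_invFun := H.exp.continuous.comp
      ((LinearMap.continuous_of_finiteDimensional
        (B.dilationLinearEquiv hγ).symm.toLinearMap).comp H.exp.symm.continuous) }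

lemma coord_groupDilation {γ : K} (hγ : γ ≠ 0) (x : G) (i : Fin d) :
    B.coord (B.groupDilation hγ x) i = γ ^ B.weight i * B.coord x i := by
  have : H.exp.symm (B.groupDilation hγ x) = B.dilation γ (H.exp.symm x) :=
    H.exp.symm_apply_apply _
  rw [coord, this, repr_dilation, coord]

lemma groupDilation_mul {γ δ : K} (hγ : γ ≠ 0) (hδ : δ ≠ 0) (hγδ : γ * δ ≠ 0) (x : G) :
    B.groupDilation hγδ x = B.groupDilation hγ (B.groupDilation hδ x) := by
  apply B.chart.injective
  ext i
  simp only [chart_apply, coord_groupDilation, mul_pow, mul_assoc]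

/-- The identity is fixed by dilation, so each coordinate c satisfies c = ϖ^w c with w ≥ 1, which
forces c = 0. No evaluation of BCH is needed. -/
lemma coord_one {ϖ : K} (hϖ : IsUniformizer ϖ) (i : Fin d) : B.coord (1 : G) i = 0 := by
  have h := B.coord_groupDilation hϖ.ne_zero (1 : G) i
  rw [map_one] at h
  by_contra h0
  have h1 : ϖ ^ B.weight i = 1 := (mul_eq_right₀ h0).1 h.symm
  have h2 : ‖ϖ‖ ^ B.weight i < 1 :=
    pow_lt_one₀ (norm_nonneg _) hϖ.norm_lt_one (by have := B.one_le_weight i; omega)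
  rw [← norm_pow, h1, norm_one] at h2
  exact lt_irrefl _ h2

variable {ϖ : K} (hϖ : IsUniformizer ϖ)
include hϖ

lemma one_mem_filtration (n : ℤ) : (1 : G) ∈ B.filtration ϖ n := by
  rw [B.mem_filtration hϖ.ne_zero]
  intro i
  rw [B.coord_one hϖ, norm_zero]
  positivity

lemma groupDilation_mem_filtration (m n : ℤ) (x : G) :
    B.groupDilation (zpow_ne_zero n hϖ.ne_zero) x ∈ B.filtration ϖ (m + n) ↔
      x ∈ B.filtration ϖ m := by
  have h0 := norm_pos_iff.2 hϖ.ne_zero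
  simp only [B.mem_filtration hϖ.ne_zero, coord_groupDilation]
  refine forall_congr' fun i => ?_
  have hpos : 0 < (‖ϖ‖ ^ n) ^ B.weight i := by positivity
  rw [norm_mul, norm_pow, norm_zpow, zpow_add₀ h0.ne', mul_pow, mul_comm]
  exact mul_le_mul_iff_left₀ hpos

lemma filtration_eq_preimage (n : ℤ) : B.filtration ϖ n =
    B.chart ⁻¹' Set.pi Set.univ fun i => Metric.closedBall 0 ((‖ϖ‖ ^ n) ^ B.weight i) := by
  ext x
  simp [B.mem_filtration hϖ.ne_zero, chart_apply]

lemma isCompact_filtration (n : ℤ) : IsCompact (B.filtration (G := G) ϖ n) := by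
  have : ProperSpace K := .of_locallyCompactSpace K
  rw [B.filtration_eq_preimage hϖ]
  exact B.chart.isCompact_preimage.2 (isCompact_univ_pi fun i => isCompact_closedBall _ _)

lemma isOpen_filtration [IsUltrametricDist K] (n : ℤ) : IsOpen (B.filtration (G := G) ϖ n) := by
  have h0 := norm_pos_iff.2 hϖ.ne_zero
  rw [B.filtration_eq_preimage hϖ]
  refine B.chart.continuous.isOpen_preimage _ (isOpen_set_pi Set.finite_univ fun i _ => ?_)
  exact IsUltrametricDist.isOpen_closedBall _ (by positivity)

lemma exists_filtration_subset {W : Set G} (hW : W ∈ nhds 1) :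
    ∃ m : ℕ, B.filtration ϖ m ⊆ W := by
  have h0 := norm_pos_iff.2 hϖ.ne_zero
  have h1 : B.chart (1 : G) = 0 := funext fun i => B.coord_one hϖ i
  have hW' : B.chart.symm ⁻¹' W ∈ nhds (0 : Fin d → K) := by
    apply B.chart.symm.continuous.continuousAt.preimage_mem_nhds
    rw [← h1, Homeomorph.symm_apply_apply]
    exact hW
  obtain ⟨ε, hε, hball⟩ := Metric.mem_nhds_iff.1 hW'
  obtain ⟨m, hm⟩ := exists_pow_lt_of_lt_one hε hϖ.norm_lt_one
  refine ⟨m, fun x hx => ?_⟩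
  have : B.chart x ∈ Metric.ball (0 : Fin d → K) ε := by
    rw [mem_ball_zero_iff, pi_norm_lt_iff hε]
    intro i
    refine ((B.mem_filtration hϖ.ne_zero).1 hx i).trans_lt (lt_of_le_of_lt ?_ hm)
    rw [zpow_natCast]
    exact pow_le_of_le_one (by positivity) (pow_le_one₀ h0.le hϖ.norm_lt_one.le)
      (by have := B.one_le_weight i; omega)
  simpa using hball this

lemma exists_mem_filtration (x : G) : ∃ n : ℤ, x ∈ B.filtration ϖ n := by
  have h0 := norm_pos_iff.2 hϖ.ne_zero
  obtain ⟨m, hm⟩ := pow_unbounded_of_one_lt ‖B.chart x‖ ((one_lt_inv₀ h0).2 hϖ.norm_lt_one)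
  refine ⟨-m, (B.mem_filtration hϖ.ne_zero).2 fun i => ?_⟩
  rw [zpow_neg, zpow_natCast, ← inv_pow]
  refine (norm_le_pi_norm (B.chart x) i).trans (hm.le.trans ?_)
  exact le_self_pow₀ (one_le_pow₀ ((one_le_inv₀ h0).2 hϖ.norm_lt_one.le))
    (by have := B.one_le_weight i; omega)

lemma exists_notMem_filtration {x : G} (hx : x ≠ 1) : ∃ n : ℤ, x ∉ B.filtration ϖ n := by
  have := B.t2Space
  obtain ⟨m, hm⟩ := B.exists_filtration_subset hϖ (isOpen_compl_singleton.mem_nhds hx.symm)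
  exact ⟨m, fun h => hm h rfl⟩

lemma exists_mem_filtration_diff {x : G} (hx : x ≠ 1) :
    ∃ n : ℤ, x ∈ B.filtration ϖ n \ B.filtration ϖ (n + 1) := by
  obtain ⟨m, hm⟩ := B.exists_notMem_filtration hϖ hx
  obtain ⟨n, hn, hmax⟩ := Int.exists_greatest_of_bdd (P := fun n => x ∈ B.filtration ϖ n)
    ⟨m, fun z hz => by
      by_contra! h
      exact hm (B.filtration_antitone hϖ h.le hz)⟩ (B.exists_mem_filtration hϖ x)
  exact ⟨n, hn, fun h => absurd (hmax _ h) (by omega)⟩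

lemma quasiNorm_one [MeasurableSpace G] (μ : Measure G) : B.quasiNorm ϖ μ 1 = 0 :=
  dif_neg fun ⟨_, _, h⟩ => h (B.one_mem_filtration hϖ _)

end Topology

end HomogeneousBasis

end GradedLieGroup

/-! ### Open subgroups comparable to the filtration, and Haar measure -/

namespace GradedLieGroup

namespace HomogeneousBasis

variable {K g G : Type*} [NontriviallyNormedField K] [LocallyCompactSpace K]
  [LieRing g] [LieAlgebra K g]
  [TopologicalSpace g] [IsTopologicalAddGroup g] [ContinuousSMul K g] [T2Space g]
  [Group G] [TopologicalSpace G]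
  {H : GradedLieGroup K g G} {d : ℕ} (B : H.HomogeneousBasis d)
  {ϖ : K} (hϖ : IsUniformizer ϖ)

/-- The elements all of whose dilates by `ϖ ^ k`, `k ≥ 0`, stabilize `G₀` under left
multiplication. -/
def contractedStabilizer : Subgroup G where
  carrier := {x | ∀ k : ℕ, ∀ y : G,
    B.groupDilation (zpow_ne_zero k hϖ.ne_zero) x * y ∈ B.filtration ϖ 0 ↔ y ∈ B.filtration ϖ 0}
  mul_mem' := fun {a b} ha hb k y => by rw [map_mul, mul_assoc, ha, hb]
  one_mem' := fun k y => by rw [map_one, one_mul]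
  inv_mem' := fun {a} ha k y => by rw [← ha k, ← mul_assoc, ← map_mul]; simp

lemma mem_contractedStabilizer {x : G} : x ∈ B.contractedStabilizer hϖ ↔ ∀ k : ℕ, ∀ y : G,
    B.groupDilation (zpow_ne_zero k hϖ.ne_zero) x * y ∈ B.filtration ϖ 0 ↔ y ∈ B.filtration ϖ 0 :=
  Iff.rfl

lemma contractedStabilizer_subset :
    (B.contractedStabilizer hϖ : Set G) ⊆ B.filtration ϖ 0 := by
  intro x hx
  have h := ((B.mem_contractedStabilizer hϖ).1 hx 0 1).2 (B.one_mem_filtration hϖ 0)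
  rw [mul_one] at h
  have h' := B.groupDilation_mem_filtration hϖ 0 ((0 : ℕ) : ℤ) x
  rw [Nat.cast_zero, add_zero] at h'
  exact h'.1 h

/-- As G_0 is compact and open, WG_0 ⊆ G_0 for a neighbourhood W of 1; intersecting with W⁻¹ gives
the equivalence. A ball G_m inside works for all k at once, since its contracted dilates stay in it.
-/
lemma exists_filtration_subset_contractedStabilizer [IsUltrametricDist K]
    [IsTopologicalGroup G] :
    ∃ m : ℕ, B.filtration ϖ m ⊆ (B.contractedStabilizer hϖ : Set G) := by
  obtain ⟨W, hW, hWsub⟩ := compact_open_separated_mul_left (B.isCompact_filtration hϖ 0)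
    (B.isOpen_filtration (G := G) hϖ 0) subset_rfl
  have hW' : W⁻¹ ∈ nhds (1 : G) := inv_mem_nhds_one G hW
  obtain ⟨m, hm⟩ := B.exists_filtration_subset hϖ (Filter.inter_mem hW hW')
  refine ⟨m, fun x hx => (B.mem_contractedStabilizer hϖ).2 fun k y => ?_⟩
  have hk := hm (B.filtration_antitone hϖ (by omega : (m : ℤ) ≤ m + k)
    ((B.groupDilation_mem_filtration hϖ m k x).2 hx))
  refine ⟨fun h => ?_, fun h => hWsub (Set.mul_mem_mul hk.1 h)⟩
  have := hWsub (Set.mul_mem_mul hk.2 h)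
  rwa [inv_mul_cancel_left] at this

lemma groupDilation_mem_contractedStabilizer {x : G} (hx : x ∈ B.contractedStabilizer hϖ) :
    B.groupDilation hϖ.ne_zero x ∈ B.contractedStabilizer hϖ := by
  refine (B.mem_contractedStabilizer hϖ).2 fun k y => ?_
  have h := (B.mem_contractedStabilizer hϖ).1 hx (k + 1) y
  rwa [show B.groupDilation (zpow_ne_zero ((k + 1 : ℕ) : ℤ) hϖ.ne_zero) x =
    B.groupDilation (zpow_ne_zero k hϖ.ne_zero) (B.groupDilation hϖ.ne_zero x) by
      rw [← B.groupDilation_mul _ _ (mul_ne_zero (zpow_ne_zero k hϖ.ne_zero) hϖ.ne_zero)]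
      congr 2
      push_cast
      rw [zpow_add_one₀ hϖ.ne_zero]] at h

/-- The increasing family of subgroups given by the dilates of `contractedStabilizer`. -/
def scaleSubgroup (n : ℤ) : Subgroup G :=
  (B.contractedStabilizer hϖ).comap
    (B.groupDilation (zpow_ne_zero n hϖ.ne_zero)).toMulEquiv.toMonoidHom

lemma mem_scaleSubgroup {n : ℤ} {x : G} : x ∈ B.scaleSubgroup hϖ n ↔
    B.groupDilation (zpow_ne_zero n hϖ.ne_zero) x ∈ B.contractedStabilizer hϖ :=
  Iff.rfl

lemma scaleSubgroup_mono : Monotone (B.scaleSubgroup hϖ) := by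
  refine monotone_int_of_le_succ fun n x hx => ?_
  rw [mem_scaleSubgroup] at hx ⊢
  have h := B.groupDilation_mem_contractedStabilizer hϖ hx
  rw [← B.groupDilation_mul _ _ (mul_ne_zero hϖ.ne_zero (zpow_ne_zero n hϖ.ne_zero))] at h
  convert h using 3
  rw [zpow_add_one₀ hϖ.ne_zero, mul_comm]

/-- With the next lemma, G_{m-n} ⊆ V_n ⊆ G_{-n} with m independent of n: the two families run in
opposite directions. -/
lemma scaleSubgroup_subset (n : ℤ) :
    (B.scaleSubgroup hϖ n : Set G) ⊆ B.filtration ϖ (-n) := fun x hx => by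
  have h := B.contractedStabilizer_subset hϖ ((B.mem_scaleSubgroup hϖ).1 hx)
  rwa [← neg_add_cancel n, B.groupDilation_mem_filtration hϖ] at h

lemma filtration_subset_scaleSubgroup {m : ℤ}
    (hm : B.filtration ϖ m ⊆ (B.contractedStabilizer hϖ : Set G)) (n : ℤ) :
    B.filtration ϖ (m - n) ⊆ (B.scaleSubgroup hϖ n : Set G) := fun x hx => by
  refine (B.mem_scaleSubgroup hϖ).2 (hm ?_)
  rwa [← sub_add_cancel m n, B.groupDilation_mem_filtration hϖ]

variable [IsUltrametricDist K] [MeasurableSpace G] [BorelSpace G]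

include hϖ in
lemma measurableSet_filtration (n : ℤ) : MeasurableSet (B.filtration (G := G) ϖ n) :=
  (B.isOpen_filtration hϖ n).measurableSet

variable [IsTopologicalGroup G] (μ : Measure G) [μ.IsHaarMeasure]

include hϖ in
-- χ is the factor by which the automorphism of dilation by ϖ scales Haar measure; its exact value
-- is never needed. It is below 1 because G_0 \ G_1 is open and, for d > 0, nonempty.
lemma exists_measure_filtration_eq (hd : 0 < d) (hμ : μ (B.filtration ϖ 0) = 1) :
    ∃ χ : ℝ≥0, 0 < χ ∧ χ < 1 ∧ ∀ n : ℤ, μ (B.filtration ϖ n) = (χ ^ n : ℝ≥0) := by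
  have := B.secondCountableTopology
  have := B.t2Space
  have := B.locallyCompactSpace
  let φ : G ≃ₜ* G := B.groupDilation (zpow_ne_zero 1 hϖ.ne_zero)
  have hφ (n : ℤ) : μ (B.filtration ϖ (n + 1)) = mulEquivHaarChar φ * μ (B.filtration ϖ n) := by
    rw [← mulEquivHaarChar_smul_preimage μ φ, ENNReal.smul_def, smul_eq_mul]
    congr 2
    ext x
    exact B.groupDilation_mem_filtration hϖ n 1 x
  have hχ := mulEquivHaarChar_pos φ
  refine ⟨mulEquivHaarChar φ, hχ, ?_, fun n => ?_⟩
  · have h1 : μ (B.filtration ϖ 1) = mulEquivHaarChar φ := by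
      have := hφ 0
      rwa [hμ, mul_one, zero_add] at this
    have hpos : 0 < μ (B.filtration ϖ 0 \ B.filtration ϖ 1) :=
      ((B.isOpen_filtration hϖ 0).sdiff (B.isCompact_filtration hϖ 1).isClosed).measure_pos μ
        (B.exists_mem_filtration_zero_diff hϖ hd)
    have hadd := measure_sdiff_add_inter (μ := μ) (s := B.filtration ϖ 0)
      (B.measurableSet_filtration hϖ 1)
    rw [Set.inter_eq_right.2 (B.filtration_antitone hϖ zero_le_one), hμ, h1] at hadd
    rw [← ENNReal.coe_lt_one_iff, ← hadd, add_comm]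
    exact ENNReal.lt_add_right ENNReal.coe_ne_top hpos.ne'
  · induction n using Int.induction_on with
    | zero => simpa using hμ
    | succ n ih => rw [hφ, ih, zpow_add_one₀ hχ.ne', mul_comm, ENNReal.coe_mul]
    | pred n ih =>
      have h := hφ (-(n : ℤ) - 1)
      rw [sub_add_cancel, ih] at h
      rw [zpow_sub_one₀ hχ.ne', mul_comm, ENNReal.coe_mul, h, ← mul_assoc, ← ENNReal.coe_mul,
        inv_mul_cancel₀ hχ.ne', ENNReal.coe_one, one_mul]

/-- The subgroups `scaleSubgroup` form a `SubgroupScale`. -/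
def subgroupScale {χ : ℝ≥0} (hχ0 : 0 < χ) (hχ1 : χ < 1)
    (hχ : ∀ n : ℤ, μ (B.filtration ϖ n) = (χ ^ n : ℝ≥0)) :
    SubgroupScale μ ((χ⁻¹ : ℝ≥0) : ℝ≥0∞) where
  V := B.scaleSubgroup hϖ
  mono := B.scaleSubgroup_mono hϖ
  measurableSet n := by
    obtain ⟨m, hm⟩ := B.exists_filtration_subset_contractedStabilizer hϖ
    refine (Subgroup.isOpen_of_mem_nhds _ (g := 1) (Filter.mem_of_superset
      ((B.isOpen_filtration hϖ (m - n)).mem_nhds (B.one_mem_filtration hϖ _))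
      (B.filtration_subset_scaleSubgroup hϖ hm n))).measurableSet
  measure_le n := by
    refine (measure_mono (B.scaleSubgroup_subset hϖ n)).trans (le_of_eq ?_)
    rw [hχ, ENNReal.rpow_intCast, zpow_neg, ← inv_zpow, ENNReal.coe_zpow (inv_pos.2 hχ0).ne']
  exists_mem x := by
    obtain ⟨m, hm⟩ := B.exists_filtration_subset_contractedStabilizer hϖ
    obtain ⟨n, hn⟩ := B.exists_mem_filtration hϖ x
    refine ⟨m - n, B.filtration_subset_scaleSubgroup hϖ hm _ ?_⟩
    rwa [sub_sub_cancel]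
  exists_notMem x hx := by
    obtain ⟨n, hn⟩ := B.exists_notMem_filtration hϖ hx
    refine ⟨-n, fun h => hn ?_⟩
    simpa using B.scaleSubgroup_subset hϖ _ h
  one_lt := by exact_mod_cast (one_lt_inv₀ hχ0).2 hχ1
  ne_top := ENNReal.coe_ne_top

end HomogeneousBasis

end GradedLieGroup

/-! ### Comparison of the quasi-norm with the gauge -/

namespace GradedLieGroup

namespace HomogeneousBasis

variable {K g G : Type*} [NontriviallyNormedField K] [LocallyCompactSpace K]
  [LieRing g] [LieAlgebra K g]
  [TopologicalSpace g] [IsTopologicalAddGroup g] [ContinuousSMul K g] [T2Space g]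
  [Group G] [TopologicalSpace G] [MeasurableSpace G]
  {H : GradedLieGroup K g G} {d : ℕ} (B : H.HomogeneousBasis d)
  {ϖ : K} (hϖ : IsUniformizer ϖ) (μ : Measure G)
  {χ : ℝ≥0} (hχ0 : 0 < χ) (hχ1 : χ < 1) (hχ : ∀ n : ℤ, μ (B.filtration ϖ n) = (χ ^ n : ℝ≥0))

include hϖ hχ0 hχ in
lemma quasiNorm_pos {x : G} (hx : x ≠ 1) : 0 < B.quasiNorm ϖ μ x := by
  obtain ⟨n, hn⟩ := B.exists_mem_filtration_diff hϖ hx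
  rw [B.quasiNorm_eq hϖ μ hχ hn]
  have : (0 : ℝ) < χ := hχ0
  positivity

variable [IsUltrametricDist K] [BorelSpace G]

include hϖ hχ in
lemma measurable_quasiNorm : Measurable (B.quasiNorm ϖ μ) := by
  have := B.t2Space
  intro s hs
  have : B.quasiNorm ϖ μ ⁻¹' s =
      (⋃ n : ℤ, (B.filtration ϖ n \ B.filtration ϖ (n + 1)) ∩
        {_x | ((χ : ℝ) ^ n) ^ (1 / (H.homDim : ℝ)) ∈ s}) ∪ ({1} ∩ {_x | (0 : ℝ) ∈ s}) := by
    ext x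
    rcases eq_or_ne x 1 with rfl | hx
    · simp [B.quasiNorm_one hϖ, B.one_mem_filtration hϖ]
    · obtain ⟨n, hn⟩ := B.exists_mem_filtration_diff hϖ hx
      simp only [Set.mem_preimage, Set.mem_union, Set.mem_iUnion, Set.mem_inter_iff,
        Set.mem_singleton_iff, hx, false_and, or_false, Set.mem_ofPred_eq]
      constructor
      · intro h
        exact ⟨n, hn, by rwa [← B.quasiNorm_eq hϖ μ hχ hn]⟩
      · rintro ⟨m, hm, h⟩
        rwa [B.quasiNorm_eq hϖ μ hχ hm]
  rw [this]
  refine (MeasurableSet.iUnion fun n => ?_).union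
    ((measurableSet_singleton 1).inter (MeasurableSet.const _))
  exact ((B.measurableSet_filtration hϖ n).diff (B.measurableSet_filtration hϖ (n + 1))).inter
    (MeasurableSet.const _)

/-- Powers of the quasi-norm are controlled by powers of the gauge of `subgroupScale`. -/
lemma exists_quasiNorm_rpow_le [IsTopologicalGroup G] [μ.IsHaarMeasure] (t : ℝ) :
    ∃ C : ℝ≥0∞, C ≠ ⊤ ∧ ∀ x : G, x ≠ 1 → ENNReal.ofReal (B.quasiNorm ϖ μ x ^ t) ≤
      C * (B.subgroupScale hϖ μ hχ0 hχ1 hχ).gauge x ^ (t / H.homDim) := by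
  obtain ⟨m, hm⟩ := B.exists_filtration_subset_contractedStabilizer hϖ
  let S := B.subgroupScale hϖ μ hχ0 hχ1 hχ
  have h1 : 1 < ((χ⁻¹ : ℝ≥0) : ℝ≥0∞) := S.one_lt
  have htop : ((χ⁻¹ : ℝ≥0) : ℝ≥0∞) ≠ ⊤ := S.ne_top
  refine ⟨((χ⁻¹ : ℝ≥0) : ℝ≥0∞) ^ ((m : ℝ) * |t / H.homDim|),
    rpow_ne_top_of_one_lt h1 htop _, fun x hx => ?_⟩
  obtain ⟨j, hj⟩ := B.exists_mem_filtration_diff hϖ hx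
  obtain ⟨n, hn⟩ := S.exists_mem_shell hx
  -- The sandwich gives -n ≤ j ≤ m - n for the two shell indices, so the exponents differ by at most
  -- m|t/Q|, whatever the sign of t.
  have hjn : -n ≤ j := by
    by_contra! hlt
    exact hj.2 (B.filtration_antitone hϖ (by omega : j + 1 ≤ -n)
      (B.scaleSubgroup_subset hϖ n hn.1))
  have hjm : j ≤ m - n := by
    by_contra! hlt
    exact hn.2 (B.filtration_subset_scaleSubgroup hϖ hm (n - 1)
      (B.filtration_antitone hϖ (by omega : m - (n - 1) ≤ j) hj.1))
  have hχ' : (0 : ℝ) < χ := hχ0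
  have hN : ENNReal.ofReal (B.quasiNorm ϖ μ x ^ t) =
      ((χ⁻¹ : ℝ≥0) : ℝ≥0∞) ^ (-(j : ℝ) * (t / H.homDim)) := by
    rw [B.quasiNorm_eq hϖ μ hχ hj, ← Real.rpow_intCast, ← Real.rpow_mul hχ'.le,
      ← Real.rpow_mul hχ'.le, ← ENNReal.ofReal_rpow_of_pos hχ', ENNReal.ofReal_coe_nnreal,
      ENNReal.coe_inv hχ0.ne', neg_mul, ENNReal.inv_rpow, ENNReal.rpow_neg, inv_inv]
    congr 1
    ring
  rw [hN, show (B.subgroupScale hϖ μ hχ0 hχ1 hχ).gauge x = _ from S.gauge_eq hn,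
    ← ENNReal.rpow_mul, rpow_mul_rpow h1 htop]
  refine ENNReal.rpow_le_rpow_of_exponent_le h1.le ?_
  have hi : (-(j : ℝ) - n) * (t / H.homDim) ≤ m * |t / H.homDim| := by
    refine (le_abs_self _).trans ?_
    rw [abs_mul]
    gcongr
    have e1 : (-n : ℝ) ≤ j := by exact_mod_cast hjn
    have e2 : (j : ℝ) ≤ m - n := by exact_mod_cast hjm
    rw [abs_le]
    constructor <;> linarith
  linarith

end HomogeneousBasis

end GradedLieGroup

lemma enorm_rieszIntegrand {G : Type*} [Group G] {N : G → ℝ} {lam : ℝ} {f : G → ℂ} {x y : G}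
    (hN : 0 < N (y⁻¹ * x)) :
    ‖rieszIntegrand N lam f x y‖ₑ = ‖f y‖ₑ * ENNReal.ofReal (N (y⁻¹ * x) ^ (-lam)) := by
  rw [rieszIntegrand, div_eq_mul_inv, enorm_mul, ← Complex.ofReal_inv, ← Real.rpow_neg hN.le,
    ← ofReal_norm (Complex.ofReal _), Complex.norm_of_nonneg (by positivity)]

end SteinWeiss

end

/-! ### The Stein-Weiss inequality on G -/

theorem mainTheorem12
    {K : Type*} [NontriviallyNormedField K] [IsUltrametricDist K] [LocallyCompactSpace K]
    [CharZero K]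
    {g : Type*} [LieRing g] [LieAlgebra K g] [FiniteDimensional K g]
    [TopologicalSpace g] [IsTopologicalAddGroup g] [ContinuousSMul K g] [T2Space g]
    {G : Type*} [Group G] [TopologicalSpace G] [IsTopologicalGroup G]
    [MeasurableSpace G] [BorelSpace G]
    (H : SteinWeiss.GradedLieGroup K g G) {d : ℕ} (B : H.HomogeneousBasis d)
    (ϖ : K) (hϖ : SteinWeiss.IsUniformizer ϖ)
    (μ : Measure G) [μ.IsHaarMeasure] (hμ : μ (B.filtration ϖ 0) = 1)
    (lam α β r s : ℝ) (hlam_pos : 0 < lam) (hlam_lt : lam < H.homDim)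
    (hr : 1 < r) (hrs : r ≤ s)
    (hβ : β < H.homDim / r.conjExponent) (hα : α < H.homDim / s) (hαβ : 0 ≤ α + β)
    (hscale : 1 / s = 1 / r + (α + β + lam) / H.homDim - 1) :
    ∃ C : ℝ≥0, 0 < C ∧ ∀ f : G → ℂ,
      MemLp (fun x => ((B.quasiNorm ϖ μ x ^ β : ℝ) : ℂ) * f x) (ENNReal.ofReal r) μ →
        (∀ᵐ x ∂μ, Integrable
          (SteinWeiss.rieszIntegrand (B.quasiNorm ϖ μ) lam f x) μ) ∧
        MemLp (fun x => ((B.quasiNorm ϖ μ x ^ (-α) : ℝ) : ℂ) *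
          SteinWeiss.rieszOp (B.quasiNorm ϖ μ) μ lam f x) (ENNReal.ofReal s) μ ∧
        eLpNorm (fun x => ((B.quasiNorm ϖ μ x ^ (-α) : ℝ) : ℂ) *
          SteinWeiss.rieszOp (B.quasiNorm ϖ μ) μ lam f x) (ENNReal.ofReal s) μ ≤
          C * eLpNorm (fun x => ((B.quasiNorm ϖ μ x ^ β : ℝ) : ℂ) * f x)
            (ENNReal.ofReal r) μ := by
  have hr0 : 0 < r := by linarith
  have hs0 : 0 < s := by linarith
  have hQ : (0 : ℝ) < H.homDim := hlam_pos.trans hlam_lt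
  have hd : 0 < d := by
    rw [Nat.pos_iff_ne_zero]
    rintro rfl
    have hsub : Subsingleton g := B.basis.equivFun.toEquiv.subsingleton
    refine hQ.ne' ?_
    simp [SteinWeiss.GradedLieGroup.homDim, Module.finrank_zero_of_subsingleton]
  have := B.secondCountableTopology
  have := B.t2Space
  have := B.locallyCompactSpace
  obtain ⟨χ, hχ0, hχ1, hχ⟩ := B.exists_measure_filtration_eq hϖ μ hd hμ
  let S := B.subgroupScale hϖ μ hχ0 hχ1 hχ
  let N := B.quasiNorm ϖ μ
  have hNm : Measurable N := B.measurable_quasiNorm hϖ μ hχ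
  have hNpos {x : G} (hx : x ≠ 1) : 0 < N x := B.quasiNorm_pos hϖ μ hχ0 hχ hx
  have hNnorm {x : G} (hx : x ≠ 1) (t : ℝ) : ‖((N x ^ t : ℝ) : ℂ)‖ₑ = ENNReal.ofReal (N x ^ t) := by
    have := hNpos hx
    rw [← ofReal_norm, Complex.norm_of_nonneg (by positivity)]
  -- The gauge is comparable to |·|^Q, so every exponent is divided by Q.
  obtain ⟨C, hC, hmain⟩ := S.exists_lintegral_kernel_rpow_le (a := α / H.homDim)
    (b := β / H.homDim) (l := lam / H.homDim) (r := r) (s := s)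
    ((div_lt_one hQ).2 hlam_lt) hr hrs
    (by
      rw [div_lt_iff₀ hQ]
      refine hβ.trans_eq ?_
      rw [Real.conjExponent]
      have : r - 1 ≠ 0 := by linarith
      field_simp)
    (by
      rw [div_lt_iff₀ hQ]
      exact hα.trans_eq (by ring))
    (by rw [← add_div]; positivity)
    (by rw [hscale]; ring)
  obtain ⟨Ca, hCa, hα'⟩ := B.exists_quasiNorm_rpow_le hϖ μ hχ0 hχ1 hχ (-α)
  obtain ⟨Cb, hCb, hβ'⟩ := B.exists_quasiNorm_rpow_le hϖ μ hχ0 hχ1 hχ (-β)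
  obtain ⟨Cl, hCl, hl'⟩ := B.exists_quasiNorm_rpow_le hϖ μ hχ0 hχ1 hχ (-lam)
  set D : ℝ≥0∞ := Ca * Cb * Cl * C ^ (1 / s) with hDdef
  have hD : D ≠ ⊤ := by
    have := ENNReal.rpow_ne_top_of_nonneg (one_div_pos.2 hs0).le hC
    finiteness
  refine ⟨D.toNNReal + 1, by positivity, fun f hf => ?_⟩
  -- Measurability of f is recovered from the weighted function by undoing the weight away from the
  -- null set {1}.
  have hfm : AEStronglyMeasurable f μ := by
    have h1 : AEStronglyMeasurable (fun x =>
        ((N x ^ (-β) : ℝ) : ℂ) * (((N x ^ β : ℝ) : ℂ) * f x)) μ :=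
      (by fun_prop : Measurable fun x => ((N x ^ (-β) : ℝ) : ℂ)).aestronglyMeasurable.mul
        hf.aestronglyMeasurable
    refine h1.congr ?_
    filter_upwards [S.ae_ne 1] with x hx
    rw [← mul_assoc, ← Complex.ofReal_mul, ← Real.rpow_add (hNpos hx)]
    simp
  have hRm : AEStronglyMeasurable (fun p : G × G => SteinWeiss.rieszIntegrand N lam f p.1 p.2)
      (μ.prod μ) := by
    simp only [SteinWeiss.rieszIntegrand, div_eq_mul_inv]
    exact hfm.comp_snd.mul
      (by fun_prop : Measurable fun p : G × G =>
        ((N (p.2⁻¹ * p.1) ^ lam : ℝ) : ℂ)⁻¹).aestronglyMeasurable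
  have hRm' (x : G) : AEStronglyMeasurable (SteinWeiss.rieszIntegrand N lam f x) μ := by
    change AEStronglyMeasurable (fun y => SteinWeiss.rieszIntegrand N lam f x y) μ
    simp only [SteinWeiss.rieszIntegrand, div_eq_mul_inv]
    exact hfm.mul (by fun_prop : Measurable fun y : G =>
        ((N (y⁻¹ * x) ^ lam : ℝ) : ℂ)⁻¹).aestronglyMeasurable
  have hOpm : AEStronglyMeasurable (fun x => ((N x ^ (-α) : ℝ) : ℂ) *
      SteinWeiss.rieszOp N μ lam f x) μ :=
    (by fun_prop : Measurable fun x => ((N x ^ (-α) : ℝ) : ℂ)).aestronglyMeasurable.mul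
      hRm.integral_prod_right'
  set J : G → ℝ≥0∞ := fun x => ∫⁻ y, ‖SteinWeiss.rieszIntegrand N lam f x y‖ₑ ∂μ with hJ
  have hJm : AEMeasurable J μ := hRm.enorm.lintegral_prod_right'
  have hFm := hf.aestronglyMeasurable.enorm
  -- A measurable version of |·|^β |f|, as the gauge inequality requires.
  set F : G → ℝ≥0∞ := hFm.mk _ with hF
  have hFint : (∫⁻ y, F y ^ r ∂μ) ^ (1 / r) =
      eLpNorm (fun x => ((N x ^ β : ℝ) : ℂ) * f x) (ENNReal.ofReal r) μ := by
    rw [eLpNorm_eq_lintegral_rpow_enorm_toReal (by simpa using hr0) (by simp),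
      ENNReal.toReal_ofReal hr0.le]
    congr 1
    refine lintegral_congr_ae ?_
    filter_upwards [hFm.ae_eq_mk] with y hy
    rw [hF, ← hy]
  have hpt {x : G} (hx : x ≠ 1) : ENNReal.ofReal (N x ^ (-α)) * J x ≤
      Ca * Cb * Cl * ∫⁻ y,
        S.kernel (α / H.homDim) (β / H.homDim) (lam / H.homDim) x y * F y ∂μ := by
    rw [hJ, ← lintegral_const_mul'' _ (hRm' x).enorm,
      ← lintegral_const_mul' _ _ (by finiteness : Ca * Cb * Cl ≠ ⊤)]
    refine lintegral_mono_ae ?_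
    filter_upwards [S.ae_ne 1, S.ae_ne x, hFm.ae_eq_mk] with y hy hyx hFy
    have hyx' : y⁻¹ * x ≠ 1 := by rwa [Ne, inv_mul_eq_one]
    have hfy : ‖f y‖ₑ = ENNReal.ofReal (N y ^ (-β)) * F y := by
      rw [hF, ← hFy, ← hNnorm hy, ← enorm_mul, ← mul_assoc, ← Complex.ofReal_mul,
        ← Real.rpow_add (hNpos hy)]
      simp
    rw [SteinWeiss.enorm_rieszIntegrand (hNpos hyx'), hfy, SteinWeiss.SubgroupScale.kernel]
    calc _ ≤ (Ca * S.gauge x ^ (-α / H.homDim)) * ((Cb * S.gauge y ^ (-β / H.homDim)) * F y *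
          (Cl * S.gauge (y⁻¹ * x) ^ (-lam / H.homDim))) := by
          gcongr
          exacts [hα' x hx, hβ' y hy, hl' _ hyx']
      _ = _ := by
          rw [neg_div, neg_div, neg_div]
          ring
  have hbound : (∫⁻ x, (ENNReal.ofReal (N x ^ (-α)) * J x) ^ s ∂μ) ^ (1 / s) ≤
      D * eLpNorm (fun x => ((N x ^ β : ℝ) : ℂ) * f x) (ENNReal.ofReal r) μ := by
    have hc : (Ca * Cb * Cl) ^ s ≠ ⊤ :=
      ENNReal.rpow_ne_top_of_nonneg hs0.le (by finiteness)
    have hexp : s / r * (1 / s) = 1 / r := by field_simp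
    calc _ ≤ (∫⁻ x, (Ca * Cb * Cl * ∫⁻ y,
          S.kernel (α / H.homDim) (β / H.homDim) (lam / H.homDim) x y * F y ∂μ) ^ s ∂μ) ^
            (1 / s) := by
          refine ENNReal.rpow_le_rpow (lintegral_mono_ae ?_) (by positivity)
          filter_upwards [S.ae_ne 1] with x hx
          exact ENNReal.rpow_le_rpow (hpt hx) hs0.le
      _ ≤ ((Ca * Cb * Cl) ^ s * (C * (∫⁻ y, F y ^ r ∂μ) ^ (s / r))) ^ (1 / s) := by
          simp_rw [ENNReal.mul_rpow_of_nonneg (Ca * Cb * Cl) _ hs0.le]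
          rw [lintegral_const_mul' _ _ hc]
          gcongr
          exact hmain F hFm.measurable_mk
      _ = _ := by
          rw [ENNReal.mul_rpow_of_nonneg ((Ca * Cb * Cl) ^ s) _ (by positivity),
            ENNReal.mul_rpow_of_nonneg C _ (by positivity), ← ENNReal.rpow_mul,
            ← ENNReal.rpow_mul, mul_one_div_cancel hs0.ne', ENNReal.rpow_one, hexp, hFint, hDdef]
          ring
  have hfin : D * eLpNorm (fun x => ((N x ^ β : ℝ) : ℂ) * f x) (ENNReal.ofReal r) μ < ⊤ :=
    ENNReal.mul_lt_top hD.lt_top hf.eLpNorm_lt_top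
  have hOp : eLpNorm (fun x => ((N x ^ (-α) : ℝ) : ℂ) * SteinWeiss.rieszOp N μ lam f x)
      (ENNReal.ofReal s) μ ≤
        D * eLpNorm (fun x => ((N x ^ β : ℝ) : ℂ) * f x) (ENNReal.ofReal r) μ := by
    refine le_trans ?_ hbound
    rw [eLpNorm_eq_lintegral_rpow_enorm_toReal (by simpa using hs0) (by simp),
      ENNReal.toReal_ofReal hs0.le]
    refine ENNReal.rpow_le_rpow (lintegral_mono_ae ?_) (by positivity)
    filter_upwards [S.ae_ne 1] with x hx
    rw [enorm_mul, hNnorm hx]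
    gcongr
    exact enorm_integral_le_lintegral_enorm _
  refine ⟨?_, ⟨hOpm, hOp.trans_lt hfin⟩, hOp.trans ?_⟩
  -- The weighted J has finite L^s norm, so it is finite almost everywhere, and so is J because the
  -- weight is nonzero off the identity.
  · have hlt : ∫⁻ x, (ENNReal.ofReal (N x ^ (-α)) * J x) ^ s ∂μ ≠ ⊤ := by
      intro h
      rw [h, ENNReal.top_rpow_of_pos (by positivity)] at hbound
      exact absurd hfin (not_lt.2 hbound)
    have hm : AEMeasurable (fun x => (ENNReal.ofReal (N x ^ (-α)) * J x) ^ s) μ :=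
      ((by fun_prop : Measurable fun x =>
        ENNReal.ofReal (N x ^ (-α))).aemeasurable.mul hJm).pow_const s
    filter_upwards [ae_lt_top' hm hlt, S.ae_ne 1] with x hx hx1
    refine ⟨hRm' x, lt_top_iff_ne_top.2 fun hJx => ?_⟩
    have hpos := hNpos hx1
    have h0 : ENNReal.ofReal (N x ^ (-α)) ≠ 0 := by
      rw [Ne, ENNReal.ofReal_eq_zero, not_le]
      positivity
    have hJx' : J x = ⊤ := hJx
    rw [hJx', ENNReal.mul_top h0, ENNReal.top_rpow_of_pos hs0] at hx
    exact lt_irrefl _ hx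
  · gcongr
    rw [ENNReal.coe_add, ENNReal.coe_toNNReal hD]
    exact le_self_add
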